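/- All $C^*$-algebras are unital and $\otimes$ is the minimal (spatial) tensor product. Let $\Gamma=(V,E,s,r)$ be a finite directed graph (loops and multiple edges allowed) that is connected in the sense that every vertex is the source or the range of some edge. Let $C^*(\Gamma)$ be its graph $C^*$-algebra: the universal $C^*$-algebra generated by mutually orthogonal projections $p_v$ ($v\in V$) with $\sum_v p_v=1$ and partial isometries $S_e$ ($e\in E$) such that $S_e^*S_e=p_{r(e)}$ for all $e$, and $p_v=\sum_{s(f)=v}S_fS_f^*$ whenever $s^{-1}(v)\neq\emptyset$. A compact quantum group is a pair $(Q,\Delta)$ of a $C^*$-algebra $Q$ and a unital $*$-homomorphism $\Delta:Q\to Q\otimes Q$ with $(\mathrm{id}\otimes\Delta)\Delta=(\Delta\otimes\mathrm{id})\Delta$ such that $\Delta(Q)(1\otimes Q)$ and $\Delta(Q)(Q\otimes1)$ have dense linear span in $Q\otimes Q$; a morphism $(Q_1,\Delta_1)\to(Q_2,\Delta_2)$ is a unital $*$-homomorphism $\Phi$ with $(\Phi\otimes\Phi)\Delta_1=\Delta_2\Phi$. Let $\mathcal V_{2,+}\subseteq C^*(\Gamma)$ be the span of the $p_u$, where $u$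 is a vertex that is not the source of an edge, and of the $S_eS_f^*$ with $r(e)=r(f)$, and let $\tau$ be the linear functional on $\mathcal V_{2,+}$ with $\tau(p_u)=1$ and $\tau(S_eS_f^*)=\delta_{ef}$ on these elements. The objects of the category $\mathfrak C_\tau^{Lin}$ are the pairs $((Q,\Delta),\alpha)$ of a compact quantum group and a unital $*$-homomorphism $\alpha:C^*(\Gamma)\to C^*(\Gamma)\otimes Q$ such that * $(\alpha\otimes\mathrm{id})\alpha=(\mathrm{id}\otimes\Delta)\alpha$, and $\alpha(C^*(\Gamma))(1\otimes Q)$ has dense linear span; * $\alpha$ is faithful: the $*$-algebra generated by the $(\theta\otimes\mathrm{id})\alpha(x)$, $\theta\in C^*(\Gamma)^*$, $x\in C^*(\Gamma)$, is dense in $Q$; * $\alpha$ is linear: $\alpha(S_e)=\sum_{f\in E}S_f\otimes q_{fe}$ for some $q_{fe}\in Q$; * $(\tau\otimes\mathrm{id})\alpha(x)=\tau(x)1$ for all $x\in\mathcal V_{2,+}$ (where $\alpha(x)$ is an element of the algebraic tensor product of $\mathcal V_{2,+}$ and $Q$). An object $((Q,\Delta),\alpha)$ is universal if for every object $((B,\Delta'),\beta)$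 there is a surjective morphism $\Phi:(Q,\Delta)\to(B,\Delta')$ with $(\mathrm{id}\otimes\Phi)\alpha=\beta$; $Q_\tau^{Lin}$ denotes the compact quantum group of the universal object. Let $F=C(S^1)*\cdots*C(S^1)$ ($|E|$ copies) be the universal $C^*$-algebra generated by unitaries $z_e$ ($e\in E$), with the comultiplication $\Delta_*(z_e)=z_e\otimes z_e$. For an automorphism $\varphi$ of a compact quantum group $(Q,\Delta)$ with $\varphi^2=\mathrm{id}$, the doubling $(\mathcal D_\varphi(Q),\Delta_\varphi)$ has the underlying $C^*$-algebra $Q\oplus Q$ and the comultiplication given by $\Delta_\varphi\zeta=(\zeta\otimes\zeta+\eta\otimes\eta\varphi)\Delta$ and $\Delta_\varphi\eta=(\zeta\otimes\eta+\eta\otimes\zeta\varphi)\Delta$, where $\zeta(a)=(a,0)$ and $\eta(a)=(0,a)$. Then: 1. Suppose that $e_1\neq e_2$ are edges with $s(e_1)=s(e_2)$ and $r(e_1)=r(e_2)$. Then $(F,\Delta_*)$ is a compact quantum group, and there is an automorphism $\varphi$ of it with $\varphi^2=\mathrm{id}$, $\varphi(z_{e_1})=z_{e_2}$, $\varphi(z_{e_2})=z_{e_1}$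 and $\varphi(z_k)=z_k$ for $k\neq e_1,e_2$. Moreover there is a unital $*$-homomorphism $\alpha:C^*(\Gamma)\to C^*(\Gamma)\otimes\mathcal D_\varphi(F)$ with $$\alpha(S_{e_1})=S_{e_1}\otimes(z_{e_1},0)+S_{e_2}\otimes(0,z_{e_2}),\quad \alpha(S_{e_2})=S_{e_2}\otimes(z_{e_2},0)+S_{e_1}\otimes(0,z_{e_1}),\quad \alpha(S_k)=S_k\otimes(z_k,z_k)\ \ (k\neq e_1,e_2),$$ and $((\mathcal D_\varphi(F),\Delta_\varphi),\alpha)$ is an object of $\mathfrak C_\tau^{Lin}$; in particular $(\mathcal D_\varphi(F),\Delta_\varphi)$ is a compact quantum group that acts faithfully on $C^*(\Gamma)$. Furthermore $Q_\tau^{Lin}$ is not isomorphic to $(F,\Delta_*)$ as a compact quantum group. 2. Consequently, if $Q_\tau^{Lin}$ is isomorphic to $(F,\Delta_*)$ as a compact quantum group, then $\Gamma$ satisfies condition (R3): for any two (possibly equal) vertices $v,w$ there is at most one edge with source $v$ and range $w$. -/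

import Mathlib

open scoped TensorProduct

universe u

noncomputable section

/-! ### C*-seminorms and the associated C*-algebra -/

/-- A C*-seminorm on a complex unital `*`-algebra. -/
structure CStarSeminorm (A : Type u) [Ring A] [StarRing A] [Algebra ℂ A] where
  toFun : A → ℝ
  nonneg' : ∀ x, 0 ≤ toFun x
  add_le' : ∀ x y, toFun (x + y) ≤ toFun x + toFun y
  smul' : ∀ (c : ℂ) x, toFun (c • x) = ‖c‖ * toFun x
  mul_le' : ∀ x y, toFun (x * y) ≤ toFun x * toFun y
  star_mul_self' : ∀ x, toFun (star x * x) = toFun x ^ 2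

namespace CStarSeminorm

variable {A : Type u} [Ring A] [StarRing A] [Algebra ℂ A]

theorem map_zero' (p : CStarSeminorm A) : p.toFun 0 = 0 := by
  simpa using p.smul' 0 0

theorem map_neg' (p : CStarSeminorm A) (x : A) : p.toFun (-x) = p.toFun x := by
  simpa using p.smul' (-1) x

theorem le_star (p : CStarSeminorm A) (x : A) : p.toFun x ≤ p.toFun (star x) := by
  have h := (p.star_mul_self' x).symm.trans_le (p.mul_le' (star x) x)
  rcases (p.nonneg' x).eq_or_lt with h0 | h0
  · rw [← h0]; exact p.nonneg' _
  · rw [sq] at h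
    exact le_of_mul_le_mul_right h h0

theorem map_star' (p : CStarSeminorm A) (x : A) : p.toFun (star x) = p.toFun x :=
  le_antisymm (by simpa using p.le_star (star x)) (p.le_star x)

/-- The pointwise supremum of a pointwise bounded set of C*-seminorms. -/
def sup (S : Set (CStarSeminorm A)) (hS : ∀ x, ∃ C : ℝ, ∀ p ∈ S, p.toFun x ≤ C) :
    CStarSeminorm A :=
  have bdd : ∀ x, BddAbove (Set.range fun p : S => p.1.toFun x) := fun x => by
    obtain ⟨C, hC⟩ := hS x
    exact ⟨C, by rintro _ ⟨p, rfl⟩; exact hC _ p.2⟩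
  { toFun := fun x => ⨆ p : S, p.1.toFun x
    nonneg' := fun x => Real.iSup_nonneg fun p => p.1.nonneg' x
    add_le' := fun x y => Real.iSup_le
      (fun p => (p.1.add_le' x y).trans (add_le_add (le_ciSup (bdd x) p) (le_ciSup (bdd y) p)))
      (add_nonneg (Real.iSup_nonneg fun p => p.1.nonneg' x)
        (Real.iSup_nonneg fun p => p.1.nonneg' y))
    smul' := fun c x => by
      simp only [smul']
      exact (Real.mul_iSup_of_nonneg (norm_nonneg c) _).symm
    mul_le' := fun x y => Real.iSup_le
      (fun p => (p.1.mul_le' x y).trans (mul_le_mul (le_ciSup (bdd x) p) (le_ciSup (bdd y) p)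
        (p.1.nonneg' y) (Real.iSup_nonneg fun p => p.1.nonneg' x)))
      (mul_nonneg (Real.iSup_nonneg fun p => p.1.nonneg' x)
        (Real.iSup_nonneg fun p => p.1.nonneg' y))
    star_mul_self' := fun x => by
      have h0 : 0 ≤ ⨆ p : S, p.1.toFun x := Real.iSup_nonneg fun p => p.1.nonneg' x
      apply le_antisymm
      · refine Real.iSup_le (fun p => ?_) (by positivity)
        rw [p.1.star_mul_self']
        exact pow_le_pow_left₀ (p.1.nonneg' x) (le_ciSup (bdd x) p) 2
      · have h1 : 0 ≤ ⨆ p : S, p.1.toFun (star x * x) := Real.iSup_nonneg fun p => p.1.nonneg' _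
        rw [← Real.le_sqrt h0 h1]
        refine Real.iSup_le (fun p => ?_) (Real.sqrt_nonneg _)
        rw [Real.le_sqrt (p.1.nonneg' x) h1, ← p.1.star_mul_self']
        exact le_ciSup (bdd _) p }

theorem le_sup (S : Set (CStarSeminorm A)) (hS : ∀ x, ∃ C : ℝ, ∀ p ∈ S, p.toFun x ≤ C)
    {p : CStarSeminorm A} (hp : p ∈ S) (x : A) : p.toFun x ≤ (sup S hS).toFun x := by
  obtain ⟨C, hC⟩ := hS x
  exact le_ciSup (f := fun p : S => p.1.toFun x)
    ⟨C, by rintro _ ⟨p, rfl⟩; exact hC _ p.2⟩ ⟨p, hp⟩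

theorem sup_le (S : Set (CStarSeminorm A)) (hS : ∀ x, ∃ C : ℝ, ∀ p ∈ S, p.toFun x ≤ C)
    (x : A) {C : ℝ} (h0 : 0 ≤ C) (hC : ∀ p ∈ S, p.toFun x ≤ C) : (sup S hS).toFun x ≤ C :=
  Real.iSup_le (fun p => hC _ p.2) h0

/-- The C*-seminorm `x ↦ ‖T x‖` of a `*`-representation `T` by bounded operators on a (not
necessarily complete) inner product space. -/
def ofOperators {E : Type u} [NormedAddCommGroup E] [InnerProductSpace ℂ E]
    (T : A →ₗ[ℂ] (E →L[ℂ] E)) (hmul : ∀ x y, T (x * y) = T x * T y)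
    (hstar : ∀ x ξ η, inner ℂ (T (star x) ξ) η = inner ℂ ξ (T x η)) : CStarSeminorm A :=
  have h1 : ∀ x, ‖T x‖ ^ 2 ≤ ‖T (star x * x)‖ := fun x => by
    rw [← Real.le_sqrt (norm_nonneg _) (norm_nonneg _)]
    refine ContinuousLinearMap.opNorm_le_bound _ (Real.sqrt_nonneg _) fun ξ => ?_
    have h : ‖T x ξ‖ ^ 2 ≤ ‖T (star x * x)‖ * ‖ξ‖ ^ 2 := by
      rw [← inner_self_eq_norm_sq (𝕜 := ℂ), ← hstar, ← mul_apply_eq_comp, ← hmul]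
      refine (RCLike.re_le_norm _).trans ((norm_inner_le_norm _ _).trans ?_)
      rw [sq, ← mul_assoc]
      exact mul_le_mul_of_nonneg_right (ContinuousLinearMap.le_opNorm _ _) (norm_nonneg _)
    rw [← Real.sqrt_sq (norm_nonneg (T x ξ)), ← Real.sqrt_sq (norm_nonneg ξ),
      ← Real.sqrt_mul (norm_nonneg _)]
    exact Real.sqrt_le_sqrt h
  { toFun := fun x => ‖T x‖
    nonneg' := fun x => norm_nonneg _
    add_le' := fun x y => by rw [map_add]; exact norm_add_le _ _
    smul' := fun c x => by rw [map_smul, norm_smul]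
    mul_le' := fun x y => by rw [hmul]; exact norm_mul_le _ _
    star_mul_self' := fun x => by
      have key : ∀ y, ‖T y‖ ≤ ‖T (star y)‖ := fun y => by
        have h := h1 y
        rw [hmul] at h
        replace h := h.trans (norm_mul_le _ _)
        rcases (norm_nonneg (T y)).eq_or_lt with h0 | h0
        · rw [← h0]; exact norm_nonneg _
        · rw [sq] at h
          exact le_of_mul_le_mul_right h h0
      refine le_antisymm ?_ (h1 x)
      rw [hmul, sq]
      refine (norm_mul_le _ _).trans (mul_le_mul_of_nonneg_right ?_ (norm_nonneg _))
      simpa using key (star x) }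

/-- The `*`-algebra `A`, regarded as a seminormed algebra with seminorm `p`. -/
def Pre (_p : CStarSeminorm A) : Type u := A

variable (p : CStarSeminorm A)

instance : Ring p.Pre := inferInstanceAs (Ring A)
instance : StarRing p.Pre := inferInstanceAs (StarRing A)
instance : Algebra ℂ p.Pre := inferInstanceAs (Algebra ℂ A)
instance [StarModule ℂ A] : StarModule ℂ p.Pre := inferInstanceAs (StarModule ℂ A)

/-- The identity map from `A` to `p.Pre`. -/
def toPre : A →⋆ₐ[ℂ] p.Pre := StarAlgHom.id ℂ A

instance : SeminormedRing p.Pre :=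
  { AddGroupSeminorm.toSeminormedAddCommGroup (E := p.Pre)
      { toFun := p.toFun
        map_zero' := p.map_zero'
        add_le' := p.add_le'
        neg' := p.map_neg' },
    (inferInstanceAs (Ring A) : Ring p.Pre) with
    norm_mul_le := p.mul_le' }

theorem norm_toPre (x : A) : ‖p.toPre x‖ = p.toFun x := rfl

instance : NormedAlgebra ℂ p.Pre where
  norm_smul_le c x := (p.smul' c x).le

/-- The C*-algebra obtained from `A` by dividing out the null space of `p` and completing. -/
def Compl : Type u := UniformSpace.Completion p.Pre

instance : NormedRing p.Compl := inferInstanceAs (NormedRing (UniformSpace.Completion p.Pre))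
instance : CompleteSpace p.Compl :=
  inferInstanceAs (CompleteSpace (UniformSpace.Completion p.Pre))
instance : Algebra ℂ p.Compl := inferInstanceAs (Algebra ℂ (UniformSpace.Completion p.Pre))
instance : NormedAlgebra ℂ p.Compl where
  norm_smul_le c x :=
    (inferInstance : NormedSpace ℂ (UniformSpace.Completion p.Pre)).norm_smul_le c x

/-- The canonical map from `A` to the completion. -/
def coeFun (x : A) : p.Compl := ((p.toPre x : p.Pre) : UniformSpace.Completion p.Pre)

theorem norm_coeFun (x : A) : ‖p.coeFun x‖ = p.toFun x :=
  UniformSpace.Completion.norm_coe (p.toPre x)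

theorem denseRange_coeFun : DenseRange p.coeFun :=
  UniformSpace.Completion.denseRange_coe (α := p.Pre)

theorem coeFun_add (x y : A) : p.coeFun (x + y) = p.coeFun x + p.coeFun y :=
  UniformSpace.Completion.coe_add (p.toPre x) (p.toPre y)

theorem coeFun_mul (x y : A) : p.coeFun (x * y) = p.coeFun x * p.coeFun y :=
  UniformSpace.Completion.coe_mul (p.toPre x) (p.toPre y)

theorem coeFun_smul (c : ℂ) (x : A) : p.coeFun (c • x) = c • p.coeFun x :=
  UniformSpace.Completion.coe_smul c (p.toPre x)

theorem coeFun_sub (x y : A) : p.coeFun (x - y) = p.coeFun x - p.coeFun y :=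
  UniformSpace.Completion.coe_sub (p.toPre x) (p.toPre y)

theorem coeFun_one : p.coeFun 1 = 1 := rfl

theorem star_isometry : Isometry (fun x : p.Pre => star x) :=
  Isometry.of_dist_eq fun x y => by
    rw [dist_eq_norm, dist_eq_norm, ← star_sub]
    exact p.map_star' (x - y)

/-- The involution of the completion, the continuous extension of the involution of `A`. -/
def starFun (x : p.Compl) : p.Compl :=
  UniformSpace.Completion.map (fun x : p.Pre => star x) x

theorem continuous_starFun : Continuous p.starFun :=
  UniformSpace.Completion.continuous_map

theorem starFun_coeFun (x : A) : p.starFun (p.coeFun x) = p.coeFun (star x) :=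
  UniformSpace.Completion.map_coe p.star_isometry.uniformContinuous _

instance : StarRing p.Compl where
  star := p.starFun
  star_involutive x := by
    refine p.denseRange_coeFun.induction_on x
      (isClosed_eq (p.continuous_starFun.comp p.continuous_starFun) continuous_id) fun a => ?_
    rw [starFun_coeFun, starFun_coeFun, star_star]
  star_mul x y := by
    refine p.denseRange_coeFun.induction_on₂
      (p := fun x y => p.starFun (x * y) = p.starFun y * p.starFun x) ?_ ?_ x y
    · have := p.continuous_starFun
      exact isClosed_eq (by fun_prop) (by fun_prop)
    · intro a b
      simp only [← coeFun_mul, starFun_coeFun, star_mul]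
  star_add x y := by
    refine p.denseRange_coeFun.induction_on₂
      (p := fun x y => p.starFun (x + y) = p.starFun x + p.starFun y) ?_ ?_ x y
    · have := p.continuous_starFun
      exact isClosed_eq (by fun_prop) (by fun_prop)
    · intro a b
      simp only [← coeFun_add, starFun_coeFun, star_add]

theorem continuous_star' : Continuous (star : p.Compl → p.Compl) := p.continuous_starFun

theorem coeFun_star (x : A) : p.coeFun (star x) = star (p.coeFun x) := (p.starFun_coeFun x).symm

instance [StarModule ℂ A] : CStarAlgebra p.Compl where
  norm_mul_self_le x := by
    refine p.denseRange_coeFun.induction_on x ?_ fun a => ?_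
    · exact isClosed_le (continuous_norm.mul continuous_norm)
        (continuous_norm.comp (p.continuous_star'.mul continuous_id))
    · rw [← coeFun_star, ← coeFun_mul, norm_coeFun, norm_coeFun, p.star_mul_self', sq]
  star_smul c x := by
    refine p.denseRange_coeFun.induction_on x ?_ fun a => ?_
    · exact isClosed_eq (p.continuous_star'.comp (continuous_const_smul c))
        (p.continuous_star'.const_smul (star c))
    · rw [← coeFun_star, ← coeFun_smul, ← coeFun_star, ← coeFun_smul, star_smul]

/-- The canonical `*`-homomorphism from `A` to the completion. -/
def coe : A →⋆ₐ[ℂ] p.Compl where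
  toFun := p.coeFun
  map_one' := rfl
  map_mul' := p.coeFun_mul
  map_zero' := rfl
  map_add' := p.coeFun_add
  commutes' c := by
    simp only [Algebra.algebraMap_eq_smul_one, coeFun_smul, coeFun_one]
  map_star' := p.coeFun_star

theorem norm_coe (x : A) : ‖p.coe x‖ = p.toFun x := p.norm_coeFun x

theorem denseRange_coe : DenseRange p.coe := p.denseRange_coeFun

variable [StarModule ℂ A]

/-- A `*`-homomorphism into a C*-algebra that is bounded by `p` extends to the completion. -/
def extend {B : Type u} [CStarAlgebra B] (f : A →⋆ₙₐ[ℂ] B) (hf : ∀ x, ‖f x‖ ≤ p.toFun x) :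
    p.Compl →⋆ₙₐ[ℂ] B :=
  have huc : UniformContinuous (fun x : p.Pre => (f x : B)) :=
    (LipschitzWith.of_dist_le_mul (K := 1) fun x y => by
      rw [dist_eq_norm, dist_eq_norm]
      have h1 := hf (x - y : A)
      rw [NNReal.coe_one, one_mul]
      refine le_trans (le_of_eq ?_) h1
      exact congrArg norm (map_sub f (x : A) (y : A)).symm).uniformContinuous
  let F : p.Compl → B := UniformSpace.Completion.extension (fun x : p.Pre => (f x : B))
  have hF : Continuous F := UniformSpace.Completion.continuous_extension
  have hFc : ∀ x : A, F (p.coeFun x) = f x := fun x =>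
    UniformSpace.Completion.extension_coe huc _
  { toFun := F
    map_smul' := fun c x => by
      refine p.denseRange_coeFun.induction_on x
        (isClosed_eq (hF.comp (continuous_const_smul c)) (hF.const_smul c)) fun a => ?_
      rw [← coeFun_smul, hFc, hFc, map_smul]; rfl
    map_zero' := by
      have := hFc 0
      rwa [map_zero] at this
    map_add' := fun x y => by
      refine p.denseRange_coeFun.induction_on₂ (p := fun x y => F (x + y) = F x + F y)
        (isClosed_eq (hF.comp continuous_add)
          ((hF.comp continuous_fst).add (hF.comp continuous_snd))) (fun a b => ?_) x y
      rw [← coeFun_add, hFc, hFc, hFc, map_add]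
    map_mul' := fun x y => by
      refine p.denseRange_coeFun.induction_on₂ (p := fun x y => F (x * y) = F x * F y)
        (isClosed_eq (hF.comp continuous_mul)
          ((hF.comp continuous_fst).mul (hF.comp continuous_snd))) (fun a b => ?_) x y
      rw [← coeFun_mul, hFc, hFc, hFc, map_mul]
    map_star' := fun x => by
      refine p.denseRange_coeFun.induction_on x
        (isClosed_eq (hF.comp p.continuous_star') (continuous_star.comp hF)) fun a => ?_
      rw [← coeFun_star, hFc, hFc, map_star] }

theorem extend_coe {B : Type u} [CStarAlgebra B] (f : A →⋆ₙₐ[ℂ] B)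
    (hf : ∀ x, ‖f x‖ ≤ p.toFun x) (x : A) : p.extend f hf (p.coe x) = f x := by
  refine UniformSpace.Completion.extension_coe (α := p.Pre) (f := fun x : p.Pre => (f x : B)) ?_ _
  exact (LipschitzWith.of_dist_le_mul (K := 1) fun x y => by
      rw [dist_eq_norm, dist_eq_norm]
      have h1 := hf (x - y : A)
      rw [NNReal.coe_one, one_mul]
      refine le_trans (le_of_eq ?_) h1
      exact congrArg norm (map_sub f (x : A) (y : A)).symm).uniformContinuous

end CStarSeminorm

/-! ### The minimal (spatial) tensor product of C*-algebras -/

namespace MinTensor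

section Rep

variable {A B : Type u} [CStarAlgebra A] [CStarAlgebra B]
variable {H K : Type u} [NormedAddCommGroup H] [InnerProductSpace ℂ H] [CompleteSpace H]
  [NormedAddCommGroup K] [InnerProductSpace ℂ K] [CompleteSpace K]

/-- For representations `π` of `A` on `H` and `σ` of `B` on `K`, the representation `π ⊗ σ` of the
algebraic tensor product of `A` and `B` by bounded operators on the algebraic tensor product
`H ⊗ K` with its Hilbert space inner product; `(π ⊗ σ) (a ⊗ b) = π a ⊗ σ b`. -/
def rep (π : A →⋆ₙₐ[ℂ] (H →L[ℂ] H)) (σ : B →⋆ₙₐ[ℂ] (K →L[ℂ] K)) :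
    A ⊗[ℂ] B →ₗ[ℂ] (H ⊗[ℂ] K →L[ℂ] H ⊗[ℂ] K) :=
  TensorProduct.lift (LinearMap.mk₂ ℂ (fun a b => TensorProduct.mapL (π a) (σ b))
    (fun a a' b => by rw [map_add, TensorProduct.mapL_add_left])
    (fun c a b => by rw [map_smul, TensorProduct.mapL_smul_left])
    (fun a b b' => by rw [map_add, TensorProduct.mapL_add_right])
    (fun c a b => by rw [map_smul, TensorProduct.mapL_smul_right]))

theorem rep_tmul (π : A →⋆ₙₐ[ℂ] (H →L[ℂ] H)) (σ : B →⋆ₙₐ[ℂ] (K →L[ℂ] K)) (a : A) (b : B) :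
    rep π σ (a ⊗ₜ b) = TensorProduct.mapL (π a) (σ b) := rfl

theorem rep_mul (π : A →⋆ₙₐ[ℂ] (H →L[ℂ] H)) (σ : B →⋆ₙₐ[ℂ] (K →L[ℂ] K)) (x y : A ⊗[ℂ] B) :
    rep π σ (x * y) = rep π σ x * rep π σ y := by
  induction x using TensorProduct.induction_on with
  | zero => rw [zero_mul, map_zero, zero_mul]
  | add x₁ x₂ h₁ h₂ => rw [add_mul, map_add, map_add, add_mul, h₁, h₂]
  | tmul a b =>
    induction y using TensorProduct.induction_on with
    | zero => rw [mul_zero, map_zero, mul_zero]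
    | add y₁ y₂ h₁ h₂ => rw [mul_add, map_add, map_add, mul_add, h₁, h₂]
    | tmul a' b' =>
      rw [Algebra.TensorProduct.tmul_mul_tmul, rep_tmul, rep_tmul, rep_tmul, map_mul, map_mul,
        TensorProduct.mapL_mul]

theorem inner_rep_star (π : A →⋆ₙₐ[ℂ] (H →L[ℂ] H)) (σ : B →⋆ₙₐ[ℂ] (K →L[ℂ] K)) (x : A ⊗[ℂ] B)
    (ξ η : H ⊗[ℂ] K) : inner ℂ (rep π σ (star x) ξ) η = inner ℂ ξ (rep π σ x η) := by
  induction x using TensorProduct.induction_on with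
  | zero => simp
  | add x₁ x₂ h₁ h₂ =>
    rw [star_add, map_add, map_add, _root_.add_apply, _root_.add_apply,
      inner_add_left, inner_add_right, h₁, h₂]
  | tmul a b =>
    rw [TensorProduct.star_tmul, rep_tmul, rep_tmul, map_star, map_star]
    induction ξ using TensorProduct.induction_on with
    | zero => simp
    | add ξ₁ ξ₂ h₁ h₂ => rw [map_add, inner_add_left, inner_add_left, h₁, h₂]
    | tmul ξ ξ' =>
      induction η using TensorProduct.induction_on with
      | zero => simp
      | add η₁ η₂ h₁ h₂ => rw [map_add, inner_add_right, inner_add_right, h₁, h₂]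
      | tmul η η' =>
        rw [TensorProduct.mapL_tmul, TensorProduct.mapL_tmul, TensorProduct.inner_tmul,
          TensorProduct.inner_tmul, ContinuousLinearMap.star_eq_adjoint,
          ContinuousLinearMap.star_eq_adjoint, ContinuousLinearMap.adjoint_inner_left,
          ContinuousLinearMap.adjoint_inner_left]

/-- The C*-seminorm `x ↦ ‖(π ⊗ σ) x‖` on the algebraic tensor product. -/
def repSeminorm (π : A →⋆ₙₐ[ℂ] (H →L[ℂ] H)) (σ : B →⋆ₙₐ[ℂ] (K →L[ℂ] K)) :
    CStarSeminorm (A ⊗[ℂ] B) :=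
  CStarSeminorm.ofOperators (E := H ⊗[ℂ] K) (rep π σ) (rep_mul π σ) (inner_rep_star π σ)

theorem repSeminorm_apply (π : A →⋆ₙₐ[ℂ] (H →L[ℂ] H)) (σ : B →⋆ₙₐ[ℂ] (K →L[ℂ] K))
    (x : A ⊗[ℂ] B) : (repSeminorm π σ).toFun x = ‖rep π σ x‖ := rfl

end Rep

variable (A B : Type u) [CStarAlgebra A] [CStarAlgebra B]

/-- The set of all seminorms `x ↦ ‖(π ⊗ σ) x‖`, where `π` and `σ` run through the
`*`-representations of `A` and of `B` on Hilbert spaces. -/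
def repSeminorms : Set (CStarSeminorm (A ⊗[ℂ] B)) :=
  {p | ∃ (H K : Type u) (_ : NormedAddCommGroup H) (_ : InnerProductSpace ℂ H)
    (_ : CompleteSpace H) (_ : NormedAddCommGroup K) (_ : InnerProductSpace ℂ K)
    (_ : CompleteSpace K) (π : A →⋆ₙₐ[ℂ] (H →L[ℂ] H)) (σ : B →⋆ₙₐ[ℂ] (K →L[ℂ] K)),
    p = repSeminorm π σ}

theorem repSeminorms_bdd (x : A ⊗[ℂ] B) : ∃ C : ℝ, ∀ p ∈ repSeminorms A B, p.toFun x ≤ C := by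
  induction x using TensorProduct.induction_on with
  | zero => exact ⟨0, fun p _ => p.map_zero'.le⟩
  | add x y hx hy =>
    obtain ⟨C, hC⟩ := hx
    obtain ⟨D, hD⟩ := hy
    exact ⟨C + D, fun p hp => (p.add_le' x y).trans (add_le_add (hC p hp) (hD p hp))⟩
  | tmul a b =>
    refine ⟨‖a‖ * ‖b‖, ?_⟩
    rintro _ ⟨H, K, _, _, _, _, _, _, π, σ, rfl⟩
    rw [repSeminorm_apply, rep_tmul]
    refine (TensorProduct.norm_mapL_le (π a) (σ b)).trans ?_
    exact mul_le_mul (NonUnitalStarAlgHom.norm_apply_le π a)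
      (NonUnitalStarAlgHom.norm_apply_le σ b) (norm_nonneg _) (norm_nonneg _)

/-- The minimal (spatial) C*-norm: the supremum of `‖(π ⊗ σ) x‖` over all pairs of
`*`-representations. -/
def minNorm : CStarSeminorm (A ⊗[ℂ] B) := .sup (repSeminorms A B) (repSeminorms_bdd A B)

end MinTensor

/-- The minimal tensor product of two C*-algebras: the completion of the algebraic tensor product
with respect to the minimal C*-norm. -/
def MinTensor (A B : Type u) [CStarAlgebra A] [CStarAlgebra B] : Type u :=
  (MinTensor.minNorm A B).Compl

namespace MinTensor

variable {A B C D : Type u} [CStarAlgebra A] [CStarAlgebra B] [CStarAlgebra C] [CStarAlgebra D]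

instance : CStarAlgebra (MinTensor A B) :=
  inferInstanceAs (CStarAlgebra (MinTensor.minNorm A B).Compl)

/-- The canonical map from the algebraic to the minimal tensor product. -/
def ofAlg : A ⊗[ℂ] B →⋆ₐ[ℂ] MinTensor A B := (MinTensor.minNorm A B).coe

theorem denseRange_ofAlg : DenseRange (ofAlg : A ⊗[ℂ] B →⋆ₐ[ℂ] MinTensor A B) :=
  (MinTensor.minNorm A B).denseRange_coe

/-- The elementary tensor `a ⊗ b` in the minimal tensor product. -/
def tmul (a : A) (b : B) : MinTensor A B := ofAlg (a ⊗ₜ[ℂ] b)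

/-- The algebraic tensor product of two `*`-homomorphisms. -/
def algMap (φ : A →⋆ₙₐ[ℂ] C) (ψ : B →⋆ₙₐ[ℂ] D) : A ⊗[ℂ] B →⋆ₙₐ[ℂ] C ⊗[ℂ] D :=
  { TensorProduct.map (φ : A →ₗ[ℂ] C) (ψ : B →ₗ[ℂ] D) with
    map_zero' := map_zero (TensorProduct.map (φ : A →ₗ[ℂ] C) (ψ : B →ₗ[ℂ] D))
    map_mul' := fun x y => by
      change TensorProduct.map (φ : A →ₗ[ℂ] C) (ψ : B →ₗ[ℂ] D) (x * y) =
        TensorProduct.map (φ : A →ₗ[ℂ] C) (ψ : B →ₗ[ℂ] D) x *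
        TensorProduct.map (φ : A →ₗ[ℂ] C) (ψ : B →ₗ[ℂ] D) y
      induction x using TensorProduct.induction_on with
      | zero => rw [zero_mul, map_zero, zero_mul]
      | add x₁ x₂ h₁ h₂ => rw [add_mul, map_add, map_add, add_mul, h₁, h₂]
      | tmul a b =>
        induction y using TensorProduct.induction_on with
        | zero => rw [mul_zero, map_zero, mul_zero]
        | add y₁ y₂ h₁ h₂ => rw [mul_add, map_add, map_add, mul_add, h₁, h₂]
        | tmul a' b' =>
          rw [Algebra.TensorProduct.tmul_mul_tmul, TensorProduct.map_tmul, TensorProduct.map_tmul,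
            TensorProduct.map_tmul, Algebra.TensorProduct.tmul_mul_tmul]
          exact congrArg₂ _ (map_mul φ a a') (map_mul ψ b b')
    map_star' := fun x => by
      change TensorProduct.map (φ : A →ₗ[ℂ] C) (ψ : B →ₗ[ℂ] D) (star x) =
        star (TensorProduct.map (φ : A →ₗ[ℂ] C) (ψ : B →ₗ[ℂ] D) x)
      induction x using TensorProduct.induction_on with
      | zero => rw [star_zero, map_zero, star_zero]
      | add x₁ x₂ h₁ h₂ => rw [star_add, map_add, map_add, star_add, h₁, h₂]
      | tmul a b =>
        rw [TensorProduct.star_tmul, TensorProduct.map_tmul, TensorProduct.map_tmul,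
          TensorProduct.star_tmul]
        exact congrArg₂ _ (map_star φ a) (map_star ψ b) }

theorem algMap_tmul (φ : A →⋆ₙₐ[ℂ] C) (ψ : B →⋆ₙₐ[ℂ] D) (a : A) (b : B) :
    algMap φ ψ (a ⊗ₜ b) = φ a ⊗ₜ ψ b := rfl

theorem rep_algMap {H K : Type u} [NormedAddCommGroup H] [InnerProductSpace ℂ H] [CompleteSpace H]
    [NormedAddCommGroup K] [InnerProductSpace ℂ K] [CompleteSpace K]
    (π : C →⋆ₙₐ[ℂ] (H →L[ℂ] H)) (σ : D →⋆ₙₐ[ℂ] (K →L[ℂ] K))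
    (φ : A →⋆ₙₐ[ℂ] C) (ψ : B →⋆ₙₐ[ℂ] D) (x : A ⊗[ℂ] B) :
    rep π σ (algMap φ ψ x) = rep (π.comp φ) (σ.comp ψ) x := by
  induction x using TensorProduct.induction_on with
  | zero => rw [map_zero, map_zero, map_zero]
  | add x y hx hy => rw [map_add, map_add, map_add, hx, hy]
  | tmul a b => rfl

theorem minNorm_algMap_le (φ : A →⋆ₙₐ[ℂ] C) (ψ : B →⋆ₙₐ[ℂ] D) (x : A ⊗[ℂ] B) :
    (minNorm C D).toFun (algMap φ ψ x) ≤ (minNorm A B).toFun x := by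
  refine CStarSeminorm.sup_le _ _ _ ((minNorm A B).nonneg' x) ?_
  rintro _ ⟨H, K, _, _, _, _, _, _, π, σ, rfl⟩
  refine le_trans (le_of_eq ?_) (CStarSeminorm.le_sup (repSeminorms A B) (repSeminorms_bdd A B)
    ⟨H, K, _, _, _, _, _, _, π.comp φ, σ.comp ψ, rfl⟩ x)
  rw [repSeminorm_apply, repSeminorm_apply, rep_algMap]

/-- The tensor product `φ ⊗ ψ` of two (not necessarily unital) `*`-homomorphisms. -/
def map (φ : A →⋆ₙₐ[ℂ] C) (ψ : B →⋆ₙₐ[ℂ] D) : MinTensor A B →⋆ₙₐ[ℂ] MinTensor C D :=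
  (minNorm A B).extend (((ofAlg : C ⊗[ℂ] D →⋆ₐ[ℂ] MinTensor C D) :
      C ⊗[ℂ] D →⋆ₙₐ[ℂ] MinTensor C D).comp (algMap φ ψ))
    fun x => ((minNorm C D).norm_coe _).le.trans (minNorm_algMap_le φ ψ x)

theorem map_ofAlg (φ : A →⋆ₙₐ[ℂ] C) (ψ : B →⋆ₙₐ[ℂ] D) (x : A ⊗[ℂ] B) :
    map φ ψ (ofAlg x) = ofAlg (algMap φ ψ x) := (minNorm A B).extend_coe _ _ x

theorem continuous_map (φ : A →⋆ₙₐ[ℂ] C) (ψ : B →⋆ₙₐ[ℂ] D) : Continuous (map φ ψ) :=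
  AddMonoidHomClass.continuous_of_bound (map φ ψ) 1 fun x => by
    rw [one_mul]; exact NonUnitalStarAlgHom.norm_apply_le (map φ ψ) x

theorem map_tmul (φ : A →⋆ₙₐ[ℂ] C) (ψ : B →⋆ₙₐ[ℂ] D) (a : A) (b : B) :
    map φ ψ (tmul a b) = tmul (φ a) (ψ b) := map_ofAlg φ ψ _

theorem tmul_mul_tmul (a a' : A) (b b' : B) : tmul a b * tmul a' b' = tmul (a * a') (b * b') := by
  rw [tmul, tmul, ← map_mul, Algebra.TensorProduct.tmul_mul_tmul]; rfl

theorem star_tmul (a : A) (b : B) : star (tmul a b) = tmul (star a) (star b) := by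
  rw [tmul, ← map_star, TensorProduct.star_tmul]; rfl

theorem one_def : (1 : MinTensor A B) = tmul 1 1 := (map_one ofAlg).symm

/-- `x` and `y` correspond to each other under the canonical isomorphism of `(A ⊗ B) ⊗ C` with
`A ⊗ (B ⊗ C)`. This isomorphism is isometric for the minimal norms, so that its graph is the closure
of the graph of the associativity isomorphism of the algebraic tensor products. -/
def AssocRel (x : MinTensor (MinTensor A B) C) (y : MinTensor A (MinTensor B C)) : Prop :=
  (x, y) ∈ closure (Set.range fun t : (A ⊗[ℂ] B) ⊗[ℂ] C =>
    ((ofAlg (TensorProduct.map (ofAlg : A ⊗[ℂ] B →⋆ₐ[ℂ] MinTensor A B).toAlgHom.toLinearMap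
        (LinearMap.id : C →ₗ[ℂ] C) t) : MinTensor (MinTensor A B) C),
     (ofAlg (TensorProduct.map (LinearMap.id : A →ₗ[ℂ] A)
        (ofAlg : B ⊗[ℂ] C →⋆ₐ[ℂ] MinTensor B C).toAlgHom.toLinearMap
        (TensorProduct.assoc ℂ A B C t)) : MinTensor A (MinTensor B C))))

/-- `b` is the slice `(θ ⊗ id) x` of `x` by the bounded functional `θ`. The slice map of `θ` is
bounded for the minimal norm, so that its graph is the closure of the graph of the map
`a ⊗ b ↦ θ a • b` on the algebraic tensor product. -/
def IsSlice (θ : A →L[ℂ] ℂ) (x : MinTensor A B) (b : B) : Prop :=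
  (x, b) ∈ closure (Set.range fun t : A ⊗[ℂ] B =>
    ((ofAlg t : MinTensor A B),
      TensorProduct.lid ℂ B (TensorProduct.map (θ : A →ₗ[ℂ] ℂ) LinearMap.id t)))

end MinTensor

/-! ### Universal C*-algebras given by generators and relations -/

/-- The free complex unital `*`-algebra on a set `X`, realised as the free algebra on the symbols
`x` (left summand) and `x*` (right summand). -/
def FreeStar (X : Type u) : Type u := FreeAlgebra ℂ (X ⊕ X)

namespace FreeStar

variable {X : Type u}

instance : Ring (FreeStar X) := inferInstanceAs (Ring (FreeAlgebra ℂ (X ⊕ X)))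
instance : Algebra ℂ (FreeStar X) := inferInstanceAs (Algebra ℂ (FreeAlgebra ℂ (X ⊕ X)))

/-- The generator corresponding to a symbol. -/
def sym (x : X ⊕ X) : FreeStar X := FreeAlgebra.ι ℂ x

/-- The generator corresponding to `x`. -/
def gen (x : X) : FreeStar X := sym (Sum.inl x)

theorem induction {P : FreeStar X → Prop} (h0 : ∀ c : ℂ, P (algebraMap ℂ _ c))
    (h1 : ∀ x, P (sym x)) (h2 : ∀ a b, P a → P b → P (a * b)) (h3 : ∀ a b, P a → P b → P (a + b))
    (a : FreeStar X) : P a := FreeAlgebra.induction ℂ (X ⊕ X) h0 h1 h2 h3 a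

/-- The algebra structure on the opposite algebra in which scalars act through their conjugates. -/
@[reducible] def conjOpAlgebra : Algebra ℂ (FreeStar X)ᵐᵒᵖ :=
  RingHom.toAlgebra' ((algebraMap ℂ (FreeStar X)ᵐᵒᵖ).comp (starRingEnd ℂ))
    fun c x => Algebra.commutes (starRingEnd ℂ c) x

/-- The involution of the free `*`-algebra, as a ring homomorphism into the opposite ring. -/
def starHom : FreeStar X →+* (FreeStar X)ᵐᵒᵖ :=
  letI : Algebra ℂ (FreeStar X)ᵐᵒᵖ := conjOpAlgebra
  (FreeAlgebra.lift ℂ (fun x : X ⊕ X => MulOpposite.op (sym x.swap)) :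
    FreeAlgebra ℂ (X ⊕ X) →ₐ[ℂ] (FreeStar X)ᵐᵒᵖ).toRingHom

theorem starHom_sym (x : X ⊕ X) : starHom (sym x) = MulOpposite.op (sym x.swap) :=
  letI : Algebra ℂ (FreeStar X)ᵐᵒᵖ := conjOpAlgebra
  FreeAlgebra.lift_ι_apply (R := ℂ) (fun x : X ⊕ X => MulOpposite.op (sym x.swap)) x

theorem starHom_algebraMap (c : ℂ) : starHom (algebraMap ℂ (FreeStar X) c) =
    MulOpposite.op (algebraMap ℂ (FreeStar X) (starRingEnd ℂ c)) :=
  letI : Algebra ℂ (FreeStar X)ᵐᵒᵖ := conjOpAlgebra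
  AlgHom.commutes (FreeAlgebra.lift ℂ (fun x : X ⊕ X => MulOpposite.op (sym x.swap)) :
    FreeAlgebra ℂ (X ⊕ X) →ₐ[ℂ] (FreeStar X)ᵐᵒᵖ) c

instance : StarRing (FreeStar X) where
  star a := (starHom a).unop
  star_involutive a := by
    refine induction (P := fun a => (starHom (starHom a).unop).unop = a) ?_ ?_ ?_ ?_ a
    · intro c; simp [starHom_algebraMap]
    · intro x; simp [starHom_sym]
    · intro a b ha hb; simp [ha, hb]
    · intro a b ha hb; simp [ha, hb]
  star_mul a b := by simp
  star_add a b := by simp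

theorem star_sym (x : X ⊕ X) : star (sym x) = sym x.swap :=
  congrArg MulOpposite.unop (starHom_sym x)

theorem star_algebraMap (c : ℂ) :
    star (algebraMap ℂ (FreeStar X) c) = algebraMap ℂ (FreeStar X) (starRingEnd ℂ c) :=
  congrArg MulOpposite.unop (starHom_algebraMap c)

instance : StarModule ℂ (FreeStar X) where
  star_smul c a := by
    rw [Algebra.smul_def, star_mul, star_algebraMap, Algebra.smul_def, Algebra.commutes]; rfl

/-- The `*`-homomorphism from the free `*`-algebra with given values on the generators. -/
def lift {B : Type u} [CStarAlgebra B] (f : X → B) : FreeStar X →⋆ₐ[ℂ] B :=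
  let F : FreeAlgebra ℂ (X ⊕ X) →ₐ[ℂ] B := FreeAlgebra.lift ℂ (Sum.elim f fun x => star (f x))
  have hF : ∀ x, F (FreeAlgebra.ι ℂ x) = Sum.elim f (fun x => star (f x)) x := fun x =>
    FreeAlgebra.lift_ι_apply (R := ℂ) _ x
  { (F : FreeStar X →ₐ[ℂ] B) with
    map_star' := fun a => by
      change F (star a : FreeStar X) = star (F a)
      refine induction (P := fun a => F (star a : FreeStar X) = star (F a)) ?_ ?_ ?_ ?_ a
      · intro c
        rw [star_algebraMap]
        refine (AlgHom.commutes F _).trans ?_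
        refine Eq.trans ?_ (congrArg star (AlgHom.commutes F c)).symm
        exact algebraMap_star_comm c
      · intro x
        rw [star_sym]
        refine (hF _).trans (Eq.trans ?_ (congrArg star (hF x)).symm)
        cases x <;> simp
      · intro a b ha hb
        rw [star_mul]
        refine (map_mul F _ _).trans (Eq.trans ?_ (congrArg star (map_mul F a b)).symm)
        rw [star_mul, ha, hb]; rfl
      · intro a b ha hb
        rw [star_add]
        refine (map_add F _ _).trans (Eq.trans ?_ (congrArg star (map_add F a b)).symm)
        rw [star_add, ha, hb]; rfl }

theorem lift_gen {B : Type u} [CStarAlgebra B] (f : X → B) (x : X) : lift f (gen x) = f x :=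
  FreeAlgebra.lift_ι_apply (R := ℂ) (Sum.elim f fun x => star (f x)) (Sum.inl x)

theorem lift_sym {B : Type u} [CStarAlgebra B] (f : X → B) (x : X ⊕ X) :
    lift f (sym x) = Sum.elim f (fun x => star (f x)) x :=
  FreeAlgebra.lift_ι_apply (R := ℂ) (Sum.elim f fun x => star (f x)) x

end FreeStar

/-- A set of relations on generators `X`, given by saying which families in C*-algebras satisfy
them. The generators are required to be contractions in all these families. -/
structure CStarRelations (X : Type u) where
  holds : ∀ (B : Type u) [CStarAlgebra B], (X → B) → Prop
  norm_le : ∀ (B : Type u) [CStarAlgebra B] (f : X → B), holds B f → ∀ x, ‖f x‖ ≤ 1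

namespace CStarRelations

variable {X : Type u} (R : CStarRelations X)

/-- The set of all C*-seminorms `a ↦ ‖lift f a‖`, where `f` runs through the families satisfying
the relations. -/
def seminorms : Set (CStarSeminorm (FreeStar X)) :=
  {p | ∃ (B : Type u) (_ : CStarAlgebra B) (f : X → B), R.holds B f ∧
    ∀ a, p.toFun a = ‖FreeStar.lift f a‖}

theorem seminorms_bdd (a : FreeStar X) : ∃ C : ℝ, ∀ p ∈ R.seminorms, p.toFun a ≤ C := by
  have key : ∃ C : ℝ, 0 ≤ C ∧ ∀ p ∈ R.seminorms, p.toFun a ≤ C := by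
    refine FreeStar.induction (P := fun a => ∃ C : ℝ, 0 ≤ C ∧ ∀ p ∈ R.seminorms, p.toFun a ≤ C)
      ?_ ?_ ?_ ?_ a
    · intro c
      refine ⟨‖c‖ * 1, by positivity, ?_⟩
      rintro p ⟨B, _, f, hf, hp⟩
      rw [hp, Algebra.algebraMap_eq_smul_one, map_smul, map_one, norm_smul]
      refine mul_le_mul_of_nonneg_left ?_ (norm_nonneg c)
      rcases subsingleton_or_nontrivial B with h | h
      · rw [Subsingleton.elim (1 : B) 0, norm_zero]; exact zero_le_one
      · exact CStarRing.norm_one.le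
    · intro x
      refine ⟨1, zero_le_one, ?_⟩
      rintro p ⟨B, _, f, hf, hp⟩
      rw [hp, FreeStar.lift_sym]
      rcases x with x | x
      · exact R.norm_le B f hf x
      · exact (norm_star (f x)).le.trans (R.norm_le B f hf x)
    · rintro a b ⟨C, hC0, hC⟩ ⟨D, hD0, hD⟩
      exact ⟨C * D, mul_nonneg hC0 hD0, fun p hp => (p.mul_le' a b).trans
        (mul_le_mul (hC p hp) (hD p hp) (p.nonneg' b) hC0)⟩
    · rintro a b ⟨C, hC0, hC⟩ ⟨D, hD0, hD⟩
      exact ⟨C + D, add_nonneg hC0 hD0, fun p hp => (p.add_le' a b).trans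
        (add_le_add (hC p hp) (hD p hp))⟩
  obtain ⟨C, _, hC⟩ := key
  exact ⟨C, hC⟩

/-- The universal C*-algebra on the generators `X` with the relations `R`: the completion of the
free `*`-algebra with respect to the largest C*-seminorm coming from a family satisfying `R`. -/
def Univ : Type u := (CStarSeminorm.sup R.seminorms R.seminorms_bdd).Compl

instance : CStarAlgebra R.Univ :=
  inferInstanceAs (CStarAlgebra (CStarSeminorm.sup R.seminorms R.seminorms_bdd).Compl)

/-- The canonical map from the free `*`-algebra. -/
def ofFree : FreeStar X →⋆ₐ[ℂ] R.Univ := (CStarSeminorm.sup R.seminorms R.seminorms_bdd).coe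

/-- The canonical generators of the universal C*-algebra. -/
def gen (x : X) : R.Univ := R.ofFree (FreeStar.gen x)

theorem denseRange_mk : DenseRange R.ofFree :=
  (CStarSeminorm.sup R.seminorms R.seminorms_bdd).denseRange_coe

/-- An identity that holds in all families satisfying the relations holds for the generators. -/
theorem ofFree_eq_of_forall (a b : FreeStar X) (h : ∀ (B : Type u) [CStarAlgebra B] (f : X → B),
    R.holds B f → FreeStar.lift f a = FreeStar.lift f b) : R.ofFree a = R.ofFree b := by
  rw [← sub_eq_zero, ← map_sub, ← norm_le_zero_iff]
  refine ((CStarSeminorm.sup R.seminorms R.seminorms_bdd).norm_coe _).le.trans ?_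
  refine CStarSeminorm.sup_le _ _ _ le_rfl ?_
  rintro p ⟨B, _, f, hf, hp⟩
  rw [hp, map_sub, h B f hf, sub_self, norm_zero]

theorem lift_le {B : Type u} [CStarAlgebra B] (f : X → B) (hf : R.holds B f) (a : FreeStar X) :
    ‖FreeStar.lift f a‖ ≤ (CStarSeminorm.sup R.seminorms R.seminorms_bdd).toFun a :=
  (CStarSeminorm.le_sup R.seminorms R.seminorms_bdd
    (p := { toFun := fun a => ‖FreeStar.lift f a‖
            nonneg' := fun a => norm_nonneg _
            add_le' := fun a b => by rw [map_add]; exact norm_add_le _ _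
            smul' := fun c a => by rw [map_smul, norm_smul]
            mul_le' := fun a b => by rw [map_mul]; exact norm_mul_le _ _
            star_mul_self' := fun a => by
              rw [map_mul, map_star, CStarRing.norm_star_mul_self, sq] })
    ⟨B, inferInstance, f, hf, fun _ => rfl⟩ a)

/-- The universal property: a family satisfying the relations induces a `*`-homomorphism. -/
def lift {B : Type u} [CStarAlgebra B] (f : X → B) (hf : R.holds B f) : R.Univ →⋆ₐ[ℂ] B :=
  let F : R.Univ →⋆ₙₐ[ℂ] B := (CStarSeminorm.sup R.seminorms R.seminorms_bdd).extend
    (FreeStar.lift f : FreeStar X →⋆ₙₐ[ℂ] B) (R.lift_le f hf)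
  have h1 : F 1 = 1 := ((CStarSeminorm.sup R.seminorms R.seminorms_bdd).extend_coe
    (FreeStar.lift f : FreeStar X →⋆ₙₐ[ℂ] B) (R.lift_le f hf) 1).trans (map_one (FreeStar.lift f))
  { toFun := F
    map_one' := h1
    map_mul' := map_mul F
    map_zero' := map_zero F
    map_add' := map_add F
    commutes' := fun c => by
      rw [Algebra.algebraMap_eq_smul_one, Algebra.algebraMap_eq_smul_one, map_smul, h1]
    map_star' := map_star F }

theorem lift_gen {B : Type u} [CStarAlgebra B] (f : X → B) (hf : R.holds B f) (x : X) :
    R.lift f hf (R.gen x) = f x :=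
  ((CStarSeminorm.sup R.seminorms R.seminorms_bdd).extend_coe
    (FreeStar.lift f : FreeStar X →⋆ₙₐ[ℂ] B) (R.lift_le f hf) (FreeStar.gen x)).trans
    (FreeStar.lift_gen f x)

end CStarRelations

/-! ### Directed graphs and their C*-algebras -/

/-- A directed graph, possibly with loops and multiple edges, with vertex set `V` and edge set `E`:
the source and the range map. -/
structure DirectedGraph (V E : Type u) where
  s : E → V
  r : E → V

theorem CStarAlgebra.norm_le_one_of_projection {B : Type u} [CStarAlgebra B] {p : B}
    (h : star p = p) (h' : p * p = p) : ‖p‖ ≤ 1 := by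
  have h2 : ‖p‖ = ‖p‖ * ‖p‖ := by
    rw [← CStarRing.norm_star_mul_self, h, h']
  rcases (norm_nonneg p).eq_or_lt with h0 | h0
  · rw [← h0]; exact zero_le_one
  · nlinarith

namespace DirectedGraph

variable {V E : Type u} (Γ : DirectedGraph V E)

/-- Every vertex is the source or the range of some edge. -/
def IsConnected : Prop := ∀ v, (∃ e, Γ.s e = v) ∨ (∃ e, Γ.r e = v)

/-- Condition (R3): given any two (possibly equal) vertices, there is at most one edge from the
first to the second. -/
def SatisfiesR3 : Prop := ∀ e f, Γ.s e = Γ.s f → Γ.r e = Γ.r f → e = f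

variable [Fintype V] [Fintype E]

open Classical in
/-- A Cuntz-Krieger `Γ`-family in a unital C*-algebra: mutually orthogonal projections `p v` with sum
`1` (the unit of the graph C*-algebra) and partial isometries `S e` with `S e* S e = p (r e)` and
`p v = ∑ S f S f*`, where `f` runs through the edges with source `v`, whenever `v` emits an edge. -/
structure IsCKFamily {B : Type u} [CStarAlgebra B] (p : V → B) (S : E → B) : Prop where
  star_p : ∀ v, star (p v) = p v
  p_mul_p : ∀ v w, p v * p w = if v = w then p v else 0
  sum_p : ∑ v, p v = 1
  partialIsometry : ∀ e, S e * star (S e) * S e = S e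
  star_S_mul_S : ∀ e, star (S e) * S e = p (Γ.r e)
  sum_S_mul_star : ∀ v, (∃ e, Γ.s e = v) →
    p v = ∑ f ∈ Finset.univ.filter (fun f => Γ.s f = v), S f * star (S f)

/-- The relations defining the graph C*-algebra, on the generators `p v` and `S e`. -/
def ckRelations : CStarRelations (V ⊕ E) where
  holds _ _ f := Γ.IsCKFamily (fun v => f (Sum.inl v)) (fun e => f (Sum.inr e))
  norm_le B _ f hf x := by
    have hp : ∀ v, ‖f (Sum.inl v)‖ ≤ 1 := fun v =>
      CStarAlgebra.norm_le_one_of_projection (hf.star_p v)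
        ((hf.p_mul_p v v).trans (if_pos rfl))
    rcases x with v | e
    · exact hp v
    · have h := hp (Γ.r e)
      rw [← hf.star_S_mul_S e, CStarRing.norm_star_mul_self] at h
      nlinarith [norm_nonneg (f (Sum.inr e))]

/-- The graph C*-algebra of `Γ`. -/
abbrev CStar : Type u := Γ.ckRelations.Univ

/-- The canonical projections of the graph C*-algebra. -/
def p (v : V) : Γ.CStar := Γ.ckRelations.gen (Sum.inl v)

/-- The canonical partial isometries of the graph C*-algebra. -/
def S (e : E) : Γ.CStar := Γ.ckRelations.gen (Sum.inr e)

end DirectedGraph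

/-! ### Compact quantum groups -/

section QuantumGroups

variable {Q Q' C : Type u} [CStarAlgebra Q] [CStarAlgebra Q'] [CStarAlgebra C]

/-- `(Q, Δ)` is a compact quantum group: `(id ⊗ Δ) Δ = (Δ ⊗ id) Δ`, and the linear spans of
`Δ(Q)(1 ⊗ Q)` and of `Δ(Q)(Q ⊗ 1)` are dense. -/
structure IsCompactQuantumGroup (Δ : Q →⋆ₐ[ℂ] MinTensor Q Q) : Prop where
  coassoc : ∀ a, MinTensor.AssocRel
    (MinTensor.map (Δ : Q →⋆ₙₐ[ℂ] MinTensor Q Q) (NonUnitalStarAlgHom.id ℂ Q) (Δ a))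
    (MinTensor.map (NonUnitalStarAlgHom.id ℂ Q) (Δ : Q →⋆ₙₐ[ℂ] MinTensor Q Q) (Δ a))
  dense_right : Dense (Submodule.span ℂ
    {x : MinTensor Q Q | ∃ a b : Q, x = Δ a * MinTensor.tmul 1 b} : Set (MinTensor Q Q))
  dense_left : Dense (Submodule.span ℂ
    {x : MinTensor Q Q | ∃ a b : Q, x = Δ a * MinTensor.tmul b 1} : Set (MinTensor Q Q))

/-- `φ` is a morphism of compact quantum groups: `(φ ⊗ φ) Δ = Δ' φ`. -/
def IsCQGMorphism (Δ : Q →⋆ₐ[ℂ] MinTensor Q Q) (Δ' : Q' →⋆ₐ[ℂ] MinTensor Q' Q')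
    (φ : Q →⋆ₐ[ℂ] Q') : Prop :=
  ∀ a, MinTensor.map (φ : Q →⋆ₙₐ[ℂ] Q') (φ : Q →⋆ₙₐ[ℂ] Q') (Δ a) = Δ' (φ a)

/-- `(Q, Δ)` and `(Q', Δ')` are isomorphic compact quantum groups. -/
def AreIsomorphicCQG (Δ : Q →⋆ₐ[ℂ] MinTensor Q Q) (Δ' : Q' →⋆ₐ[ℂ] MinTensor Q' Q') : Prop :=
  ∃ ψ : Q ≃⋆ₐ[ℂ] Q', IsCQGMorphism Δ Δ' (ψ : Q →⋆ₐ[ℂ] Q')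

/-- `α` is a faithful action of the compact quantum group `(Q, Δ)` on the C*-algebra `C`. -/
structure IsFaithfulAction (Δ : Q →⋆ₐ[ℂ] MinTensor Q Q) (α : C →⋆ₐ[ℂ] MinTensor C Q) : Prop where
  coaction : ∀ x, MinTensor.AssocRel
    (MinTensor.map (α : C →⋆ₙₐ[ℂ] MinTensor C Q) (NonUnitalStarAlgHom.id ℂ Q) (α x))
    (MinTensor.map (NonUnitalStarAlgHom.id ℂ C) (Δ : Q →⋆ₙₐ[ℂ] MinTensor Q Q) (α x))
  dense : Dense (Submodule.span ℂ
    {y : MinTensor C Q | ∃ (x : C) (b : Q), y = α x * MinTensor.tmul 1 b} : Set (MinTensor C Q))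
  faithful : Dense (StarAlgebra.adjoin ℂ
    {b : Q | ∃ (θ : C →L[ℂ] ℂ) (x : C), MinTensor.IsSlice θ (α x) b} : Set Q)

/-! The doubling of a compact quantum group -/

/-- The first embedding `ζ a = (a, 0)` of `Q` into `Q ⊕ Q`. -/
def zetaHom (Q : Type u) [CStarAlgebra Q] : Q →⋆ₙₐ[ℂ] Q × Q where
  toFun a := (a, 0)
  map_smul' c a := by simp
  map_zero' := rfl
  map_add' a b := by simp
  map_mul' a b := by simp
  map_star' a := by simp [Prod.ext_iff]

/-- The second embedding `η a = (0, a)` of `Q` into `Q ⊕ Q`. -/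
def etaHom (Q : Type u) [CStarAlgebra Q] : Q →⋆ₙₐ[ℂ] Q × Q where
  toFun a := (0, a)
  map_smul' c a := by simp
  map_zero' := rfl
  map_add' a b := by simp
  map_mul' a b := by simp
  map_star' a := by simp [Prod.ext_iff]

theorem MinTensor.map_mul_map_eq_zero {A₁ A₂ B₁ B₂ D₁ D₂ : Type u} [CStarAlgebra A₁]
    [CStarAlgebra A₂] [CStarAlgebra B₁] [CStarAlgebra B₂] [CStarAlgebra D₁] [CStarAlgebra D₂]
    (f : A₁ →⋆ₙₐ[ℂ] D₁) (g : B₁ →⋆ₙₐ[ℂ] D₂) (f' : A₂ →⋆ₙₐ[ℂ] D₁) (g' : B₂ →⋆ₙₐ[ℂ] D₂)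
    (h : (∀ a a', f a * f' a' = 0) ∨ (∀ b b', g b * g' b' = 0))
    (x : MinTensor A₁ B₁) (y : MinTensor A₂ B₂) :
    MinTensor.map f g x * MinTensor.map f' g' y = 0 := by
  have alg : ∀ (s : A₁ ⊗[ℂ] B₁) (t : A₂ ⊗[ℂ] B₂),
      MinTensor.algMap f g s * MinTensor.algMap f' g' t = 0 := by
    intro s t
    induction s using TensorProduct.induction_on with
    | zero => rw [map_zero, zero_mul]
    | add s₁ s₂ h₁ h₂ => rw [map_add, add_mul, h₁, h₂, add_zero]
    | tmul a b =>
      induction t using TensorProduct.induction_on with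
      | zero => rw [map_zero, mul_zero]
      | add t₁ t₂ h₁ h₂ => rw [map_add, mul_add, h₁, h₂, add_zero]
      | tmul a' b' =>
        rw [MinTensor.algMap_tmul, MinTensor.algMap_tmul, Algebra.TensorProduct.tmul_mul_tmul]
        rcases h with h | h
        · rw [h, TensorProduct.zero_tmul]
        · rw [h, TensorProduct.tmul_zero]
  have c₁ : Continuous (MinTensor.map f g) := MinTensor.continuous_map f g
  have c₂ : Continuous (MinTensor.map f' g') := MinTensor.continuous_map f' g'
  refine MinTensor.denseRange_ofAlg.induction_on x
    (isClosed_eq (c₁.mul continuous_const) continuous_const) fun s => ?_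
  refine MinTensor.denseRange_ofAlg.induction_on y
    (isClosed_eq (continuous_const.mul c₂) continuous_const) fun t => ?_
  rw [MinTensor.map_ofAlg, MinTensor.map_ofAlg, ← map_mul, alg, map_zero]

/-- The embeddings `ζ` (`false`) and `η` (`true`). -/
def doublingEmb (Q : Type u) [CStarAlgebra Q] : Bool → (Q →⋆ₙₐ[ℂ] Q × Q)
  | false => zetaHom Q
  | true => etaHom Q

/-- The map `(ε_i ⊗ (ε_j φ^i)) Δ`, where `ε_false = ζ`, `ε_true = η`, and `φ^i` is `id` if `i` is
`false` and `φ` if `i` is `true`. -/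
def doublingComponent (Δ : Q →⋆ₐ[ℂ] MinTensor Q Q) (φ : Q →⋆ₐ[ℂ] Q) (i j : Bool) :
    Q →⋆ₙₐ[ℂ] MinTensor (Q × Q) (Q × Q) :=
  (MinTensor.map (doublingEmb Q i) (match i with
    | false => doublingEmb Q j
    | true => (doublingEmb Q j).comp (φ : Q →⋆ₙₐ[ℂ] Q))).comp (Δ : Q →⋆ₙₐ[ℂ] MinTensor Q Q)

theorem doublingEmb_mul {i j : Bool} (h : i ≠ j) (a b : Q) :
    doublingEmb Q i a * doublingEmb Q j b = 0 := by
  cases i <;> cases j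
  · exact absurd rfl h
  · change (a * 0, 0 * b) = 0; simp
  · change (0 * b, a * 0) = 0; simp
  · exact absurd rfl h

theorem doublingComponent_mul (Δ : Q →⋆ₐ[ℂ] MinTensor Q Q) (φ : Q →⋆ₐ[ℂ] Q) {i j k l : Bool}
    (h : (i, j) ≠ (k, l)) (a b : Q) :
    doublingComponent Δ φ i j a * doublingComponent Δ φ k l b = 0 := by
  refine MinTensor.map_mul_map_eq_zero _ _ _ _ ?_ (Δ a) (Δ b)
  by_cases hik : i = k
  · right
    have hjl : j ≠ l := fun hjl => h (by rw [hik, hjl])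
    intro a b
    subst hik
    cases i
    · exact doublingEmb_mul hjl _ _
    · exact doublingEmb_mul hjl _ _
  · left
    exact doublingEmb_mul hik

/-- The comultiplication `Δ_φ` of the doubling of `(Q, Δ)` by the involutive automorphism `φ`, with
underlying C*-algebra `Q ⊕ Q`; it is determined by
`Δ_φ ζ = (ζ ⊗ ζ + η ⊗ (η φ)) Δ` and `Δ_φ η = (ζ ⊗ η + η ⊗ (ζ φ)) Δ`. -/
def doublingComul (Δ : Q →⋆ₐ[ℂ] MinTensor Q Q) (φ : Q →⋆ₐ[ℂ] Q) :
    Q × Q →⋆ₐ[ℂ] MinTensor (Q × Q) (Q × Q) :=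
  let c := doublingComponent Δ φ
  have one : c false false 1 + c true true 1 + (c false true 1 + c true false 1) = 1 := by
    have e : Δ 1 = MinTensor.tmul 1 1 := (map_one Δ).trans MinTensor.one_def
    change MinTensor.map (zetaHom Q) (zetaHom Q) (Δ 1) +
      MinTensor.map (etaHom Q) ((etaHom Q).comp (φ : Q →⋆ₙₐ[ℂ] Q)) (Δ 1) +
      (MinTensor.map (zetaHom Q) (etaHom Q) (Δ 1) +
      MinTensor.map (etaHom Q) ((zetaHom Q).comp (φ : Q →⋆ₙₐ[ℂ] Q)) (Δ 1)) = 1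
    rw [e, MinTensor.map_tmul, MinTensor.map_tmul, MinTensor.map_tmul, MinTensor.map_tmul]
    have hφ : (φ : Q →⋆ₙₐ[ℂ] Q) 1 = 1 := map_one φ
    rw [NonUnitalStarAlgHom.comp_apply, NonUnitalStarAlgHom.comp_apply, hφ, MinTensor.one_def]
    have hs : zetaHom Q 1 + etaHom Q 1 = 1 := by
      change ((1 + 0, 0 + 1) : Q × Q) = 1
      simp [Prod.ext_iff]
    rw [← hs]
    simp only [MinTensor.tmul, ← map_add, TensorProduct.add_tmul, TensorProduct.tmul_add]
    congr 1
    abel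
  { toFun := fun x => c false false x.1 + c true true x.1 + (c false true x.2 + c true false x.2)
    map_one' := one
    map_mul' := fun x y => by
      have hz : ∀ {i j k l : Bool}, (i, j) ≠ (k, l) → ∀ a b, c i j a * c k l b = 0 :=
        fun h a b => doublingComponent_mul Δ φ h a b
      simp only [Prod.fst_mul, Prod.snd_mul, map_mul, mul_add, add_mul]
      rw [hz (i := true) (j := true) (k := false) (l := false) (by simp),
        hz (i := false) (j := true) (k := false) (l := false) (by simp),
        hz (i := true) (j := false) (k := false) (l := false) (by simp),
        hz (i := false) (j := false) (k := true) (l := true) (by simp),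
        hz (i := false) (j := true) (k := true) (l := true) (by simp),
        hz (i := true) (j := false) (k := true) (l := true) (by simp),
        hz (i := false) (j := false) (k := false) (l := true) (by simp),
        hz (i := true) (j := true) (k := false) (l := true) (by simp),
        hz (i := true) (j := false) (k := false) (l := true) (by simp),
        hz (i := false) (j := false) (k := true) (l := false) (by simp),
        hz (i := true) (j := true) (k := true) (l := false) (by simp),
        hz (i := false) (j := true) (k := true) (l := false) (by simp)]
      simp only [add_zero, zero_add]
    map_zero' := by simp only [Prod.fst_zero, Prod.snd_zero, map_zero, add_zero]
    map_add' := fun x y => by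
      simp only [Prod.fst_add, Prod.snd_add, map_add]
      abel
    commutes' := fun z => by
      rw [Algebra.algebraMap_eq_smul_one, Algebra.algebraMap_eq_smul_one]
      simp only [Prod.smul_fst, Prod.smul_snd, Prod.fst_one, Prod.snd_one, map_smul]
      rw [← smul_add, ← smul_add, ← smul_add, one]
    map_star' := fun x => by
      simp only [Prod.fst_star, Prod.snd_star, map_star, star_add] }

theorem doublingComul_zeta (Δ : Q →⋆ₐ[ℂ] MinTensor Q Q) (φ : Q →⋆ₐ[ℂ] Q) (a : Q) :
    doublingComul Δ φ (zetaHom Q a) =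
      MinTensor.map (zetaHom Q) (zetaHom Q) (Δ a) +
      MinTensor.map (etaHom Q) ((etaHom Q).comp (φ : Q →⋆ₙₐ[ℂ] Q)) (Δ a) := by
  change doublingComponent Δ φ false false a + doublingComponent Δ φ true true a +
    (doublingComponent Δ φ false true 0 + doublingComponent Δ φ true false 0) = _
  rw [map_zero, map_zero, add_zero, add_zero]; rfl

theorem doublingComul_eta (Δ : Q →⋆ₐ[ℂ] MinTensor Q Q) (φ : Q →⋆ₐ[ℂ] Q) (a : Q) :
    doublingComul Δ φ (etaHom Q a) =
      MinTensor.map (zetaHom Q) (etaHom Q) (Δ a) +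
      MinTensor.map (etaHom Q) ((zetaHom Q).comp (φ : Q →⋆ₙₐ[ℂ] Q)) (Δ a) := by
  change doublingComponent Δ φ false false 0 + doublingComponent Δ φ true true 0 +
    (doublingComponent Δ φ false true a + doublingComponent Δ φ true false a) = _
  rw [map_zero, map_zero, zero_add, zero_add]; rfl

end QuantumGroups

/-! ### The free product of copies of `C(S¹)` -/

/-- The relations saying that all generators are unitary. -/
def unitaryRelations (E : Type u) : CStarRelations E where
  holds _ _ f := ∀ e, star (f e) * f e = 1 ∧ f e * star (f e) = 1
  norm_le B _ f hf x := by
    have h : ‖f x‖ * ‖f x‖ ≤ 1 := by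
      rw [← CStarRing.norm_star_mul_self, (hf x).1]
      rcases subsingleton_or_nontrivial B with h | h
      · rw [Subsingleton.elim (1 : B) 0, norm_zero]; exact zero_le_one
      · exact CStarRing.norm_one.le
    nlinarith [norm_nonneg (f x)]

/-- The free product of copies of `C(S¹)`, one copy for every element of `E`: the universal
C*-algebra generated by unitaries indexed by `E`. -/
abbrev FreeCircles (E : Type u) : Type u := (unitaryRelations E).Univ

namespace FreeCircles

variable {E : Type u}

/-- The canonical unitary generators. -/
def z (e : E) : FreeCircles E := (unitaryRelations E).gen e

theorem z_unitary (e : E) : star (z e) * z e = 1 ∧ z e * star (z e) = 1 := by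
  have h1 := (unitaryRelations E).ofFree_eq_of_forall
    (star (FreeStar.gen e) * FreeStar.gen e) 1 (fun B _ f hf => by
      rw [map_mul, map_star, map_one, FreeStar.lift_gen, (hf e).1])
  have h2 := (unitaryRelations E).ofFree_eq_of_forall
    (FreeStar.gen e * star (FreeStar.gen e)) 1 (fun B _ f hf => by
      rw [map_mul, map_star, map_one, FreeStar.lift_gen, (hf e).2])
  rw [map_mul, map_star, map_one] at h1 h2
  exact ⟨h1, h2⟩

/-- The comultiplication `Δ_*` of the free product of copies of `C(S¹)`, with
`Δ_*(z e) = z e ⊗ z e`. -/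
def comul (E : Type u) : FreeCircles E →⋆ₐ[ℂ] MinTensor (FreeCircles E) (FreeCircles E) :=
  (unitaryRelations E).lift (fun e => MinTensor.tmul (z e) (z e)) fun e => by
    rw [MinTensor.star_tmul, MinTensor.tmul_mul_tmul, MinTensor.tmul_mul_tmul, (z_unitary e).1,
      (z_unitary e).2]
    exact ⟨MinTensor.one_def.symm, MinTensor.one_def.symm⟩

theorem comul_z (e : E) : comul E (z e) = MinTensor.tmul (z e) (z e) :=
  (unitaryRelations E).lift_gen _ _ e

end FreeCircles

/-! ### Quantum symmetry of graph C*-algebras -/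

namespace DirectedGraph

variable {V E : Type u} [Fintype V] [Fintype E] (Γ : DirectedGraph V E)

theorem isCKFamily_canonical : Γ.IsCKFamily Γ.p Γ.S := by
  classical
  have key := fun a b h => Γ.ckRelations.ofFree_eq_of_forall a b h
  constructor
  · intro v
    have h := key (star (FreeStar.gen (Sum.inl v))) (FreeStar.gen (Sum.inl v)) fun B _ f hf => by
      rw [map_star, FreeStar.lift_gen]; exact hf.star_p v
    rwa [map_star] at h
  · intro v w
    have h := key (FreeStar.gen (Sum.inl v) * FreeStar.gen (Sum.inl w))
      (if v = w then FreeStar.gen (Sum.inl v) else 0) fun B _ f hf => by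
        have h' := hf.p_mul_p v w
        split_ifs at h' ⊢ <;> simpa [FreeStar.lift_gen] using h'
    rw [map_mul] at h
    refine h.trans ?_
    split_ifs
    · rfl
    · exact map_zero _
  · have h := key (∑ v, FreeStar.gen (Sum.inl v)) 1 fun B _ f hf => by
      rw [map_sum, map_one]
      simp only [FreeStar.lift_gen]
      exact hf.sum_p
    rw [map_sum, map_one] at h
    exact h
  · intro e
    have h := key (FreeStar.gen (Sum.inr e) * star (FreeStar.gen (Sum.inr e)) *
      FreeStar.gen (Sum.inr e)) (FreeStar.gen (Sum.inr e)) fun B _ f hf => by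
        simp only [map_mul, map_star, FreeStar.lift_gen]
        exact hf.partialIsometry e
    simp only [map_mul, map_star] at h
    exact h
  · intro e
    have h := key (star (FreeStar.gen (Sum.inr e)) * FreeStar.gen (Sum.inr e))
      (FreeStar.gen (Sum.inl (Γ.r e))) fun B _ f hf => by
        simp only [map_mul, map_star, FreeStar.lift_gen]
        exact hf.star_S_mul_S e
    simp only [map_mul, map_star] at h
    exact h
  · intro v hv
    have h := key (FreeStar.gen (Sum.inl v)) (∑ f ∈ Finset.univ.filter (fun f => Γ.s f = v),
      FreeStar.gen (Sum.inr f) * star (FreeStar.gen (Sum.inr f))) fun B _ f hf => by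
        simp only [map_sum, map_mul, map_star, FreeStar.lift_gen]
        convert hf.sum_S_mul_star v hv
    simp only [map_sum, map_mul, map_star] at h
    refine Eq.trans h (Finset.sum_congr ?_ fun _ _ => rfl)
    congr

/-- The subspace `V_{2,+}` of the graph C*-algebra, spanned by the projections `p u` of the vertices
`u` that emit no edge and by the elements `S e S f*` with `r e = r f`. -/
def V2plus : Submodule ℂ Γ.CStar :=
  Submodule.span ℂ ({x | ∃ u, (∀ e, Γ.s e ≠ u) ∧ x = Γ.p u} ∪
    {x | ∃ e f, Γ.r e = Γ.r f ∧ x = Γ.S e * star (Γ.S f)})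

open Classical in
/-- `τ` is the linear functional on `V_{2,+}` with `τ (p u) = 1` and `τ (S e S f*) = δ_{ef}` for the
spanning elements of `V_{2,+}`. -/
def IsTau (τ : Γ.V2plus →ₗ[ℂ] ℂ) : Prop :=
  (∀ (x : Γ.V2plus) (u : V), (∀ e, Γ.s e ≠ u) → (x : Γ.CStar) = Γ.p u → τ x = 1) ∧
  (∀ (x : Γ.V2plus) (e f : E), Γ.r e = Γ.r f → (x : Γ.CStar) = Γ.S e * star (Γ.S f) →
    τ x = if e = f then 1 else 0)

variable {Q : Type u} [CStarAlgebra Q]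

/-- `α` is linear: `α (S e) = ∑ f, S f ⊗ q f e` for suitable elements `q f e` of `Q`. -/
def IsLinearAction (α : Γ.CStar →⋆ₐ[ℂ] MinTensor Γ.CStar Q) : Prop :=
  ∃ q : E → E → Q, ∀ e, α (Γ.S e) = ∑ f, MinTensor.tmul (Γ.S f) (q f e)

/-- `α` preserves `τ`: for `x` in `V_{2,+}` the element `α x` lies in the algebraic tensor product
`V_{2,+} ⊗ Q`, and `(τ ⊗ id) (α x) = τ x • 1`. -/
def PreservesTau (α : Γ.CStar →⋆ₐ[ℂ] MinTensor Γ.CStar Q) : Prop :=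
  ∃ τ : Γ.V2plus →ₗ[ℂ] ℂ, Γ.IsTau τ ∧ ∀ x : Γ.V2plus, ∃ y : Γ.V2plus ⊗[ℂ] Q,
    MinTensor.ofAlg (TensorProduct.map Γ.V2plus.subtype LinearMap.id y) = α x ∧
    TensorProduct.lid ℂ Q (TensorProduct.map τ LinearMap.id y) = τ x • (1 : Q)

/-- `((Q, Δ), α)` is an object of the category `𝔆_τ^Lin` of `Γ`: a compact quantum group with a
faithful linear `τ`-preserving action on the graph C*-algebra. -/
structure IsObject (Δ : Q →⋆ₐ[ℂ] MinTensor Q Q) (α : Γ.CStar →⋆ₐ[ℂ] MinTensor Γ.CStar Q) :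
    Prop where
  isCQG : IsCompactQuantumGroup Δ
  faithfulAction : IsFaithfulAction Δ α
  isLinear : Γ.IsLinearAction α
  preservesTau : Γ.PreservesTau α

/-- `((Q, Δ), α)` is a universal object of `𝔆_τ^Lin`: it is an object, and for every object
`((B, Δ'), β)` there is a surjective morphism `Φ` of compact quantum groups from `Q` to `B` with
`(id ⊗ Φ) α = β`. -/
def IsUniversalObject (Δ : Q →⋆ₐ[ℂ] MinTensor Q Q)
    (α : Γ.CStar →⋆ₐ[ℂ] MinTensor Γ.CStar Q) : Prop :=
  Γ.IsObject Δ α ∧ ∀ (B : Type u) [CStarAlgebra B] (Δ' : B →⋆ₐ[ℂ] MinTensor B B)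
    (β : Γ.CStar →⋆ₐ[ℂ] MinTensor Γ.CStar B), Γ.IsObject Δ' β →
    ∃ Φ : Q →⋆ₐ[ℂ] B, Function.Surjective Φ ∧ IsCQGMorphism Δ Δ' Φ ∧
      ∀ x, MinTensor.map (NonUnitalStarAlgHom.id ℂ Γ.CStar) (Φ : Q →⋆ₙₐ[ℂ] B) (α x) = β x

end DirectedGraph

end

/-!
The free product `F` of circles is a quantum group acting by `S e ↦ S e ⊗ z e`. A permutation `σ` of
the edges that fixes every source and range permutes the generators of `C*(Γ)` and those of `F`
compatibly, and an action `α` of any quantum group `Q` that is compatible with order-two symmetries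
`θ` of the algebra and `φ` of `Q` doubles to the action `(id ⊗ ζ) α + (id ⊗ η) α θ` of `𝒟_φ(Q)`.
Doubling the action of `F` along the swap of two parallel edges gives the object `𝒟_φ(F)`. It is
faithful: when `σ e ≠ e`, the pair `(z e, 0)` is a coefficient of the action, so the coefficients
generate `(1, 0) = (star (z e), 0) (z e, 0)`, and this unit separates the two summands of every
other coefficient.

If the universal quantum group were `F`, then `𝒟_φ(F)` would be a quotient of it. The generators of
`F` are group-like, so its characters form a commutative semigroup under convolution, as do those of
any quotient. On `𝒟_φ(F)`, two characters `χ` and `ψ` that live on the second summand have a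
convolution product that restricts to `z e ↦ χ (z e) ψ (z (σ e))` on the first one, which is not
symmetric in `χ` and `ψ` when `σ e ≠ e`.
-/

noncomputable section

open scoped CStarAlgebra

/-! ### Minimal tensor products -/

namespace CStarRelations

variable {X : Type u} (R : CStarRelations X)

theorem univ_induction {P : R.Univ → Prop} (isClosed : IsClosed {a | P a}) (one : P 1)
    (gen : ∀ x, P (R.gen x)) (star_gen : ∀ x, P (star (R.gen x)))
    (smul : ∀ (c : ℂ) a, P a → P (c • a)) (mul : ∀ a b, P a → P b → P (a * b))
    (add : ∀ a b, P a → P b → P (a + b)) (a : R.Univ) : P a := by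
  refine R.denseRange_mk.induction_on a isClosed fun t => ?_
  refine FreeStar.induction (P := fun t => P (R.ofFree t)) (fun c => ?_) ?_ (fun a b ha hb => ?_)
    (fun a b ha hb => ?_) t
  · rw [Algebra.algebraMap_eq_smul_one, map_smul, map_one]
    exact smul c 1 one
  · rintro (x | x)
    · exact gen x
    · have star_sym_inl : star (FreeStar.gen x) = FreeStar.sym (Sum.inr x) := FreeStar.star_sym _
      rw [← star_sym_inl, map_star]
      exact star_gen x
  · rw [map_mul]
    exact mul _ _ ha hb
  · rw [map_add]
    exact add _ _ ha hb

theorem univ_hom_ext {B : Type u} [CStarAlgebra B] {f g : R.Univ →⋆ₙₐ[ℂ] B} (one : f 1 = g 1)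
    (gen : ∀ x, f (R.gen x) = g (R.gen x)) (a : R.Univ) : f a = g a := by
  refine R.univ_induction (P := fun a => f a = g a)
    (isClosed_eq (map_continuous f) (map_continuous g)) one gen (fun x => ?_) (fun c a h => ?_)
    (fun a b ha hb => ?_) (fun a b ha hb => ?_) a
  · rw [map_star, map_star, gen]
  · rw [map_smul, map_smul, h]
  · rw [map_mul, map_mul, ha, hb]
  · rw [map_add, map_add, ha, hb]

end CStarRelations

namespace MinTensor

variable {A B C D A' B' C' : Type u} [CStarAlgebra A] [CStarAlgebra B] [CStarAlgebra C]
  [CStarAlgebra D] [CStarAlgebra A'] [CStarAlgebra B'] [CStarAlgebra C']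

theorem tmul_add (a : A) (b b' : B) : tmul a (b + b') = tmul a b + tmul a b' := by
  simp only [tmul, TensorProduct.tmul_add, map_add]

theorem add_tmul (a a' : A) (b : B) : tmul (a + a') b = tmul a b + tmul a' b := by
  simp only [tmul, TensorProduct.add_tmul, map_add]

theorem tmul_smul (c : ℂ) (a : A) (b : B) : tmul a (c • b) = c • tmul a b := by
  simp only [tmul, TensorProduct.tmul_smul, map_smul]

theorem smul_tmul (c : ℂ) (a : A) (b : B) : tmul (c • a) b = c • tmul a b := by
  rw [tmul, tmul, ← map_smul, TensorProduct.smul_tmul']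

theorem tmul_zero (a : A) : tmul a (0 : B) = 0 := by
  rw [tmul, TensorProduct.tmul_zero, map_zero]

theorem zero_tmul (b : B) : tmul (0 : A) b = 0 := by
  rw [tmul, TensorProduct.zero_tmul, map_zero]

theorem sum_tmul {ι : Type*} (s : Finset ι) (f : ι → A) (b : B) :
    tmul (∑ i ∈ s, f i) b = ∑ i ∈ s, tmul (f i) b := by
  simp only [tmul, TensorProduct.sum_tmul, map_sum]

theorem tmul_sum {ι : Type*} (a : A) (s : Finset ι) (f : ι → B) :
    tmul a (∑ i ∈ s, f i) = ∑ i ∈ s, tmul a (f i) := by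
  simp only [tmul, TensorProduct.tmul_sum, map_sum]

/-- The canonical embedding `a ↦ a ⊗ 1`. -/
def includeLeft : A →⋆ₐ[ℂ] MinTensor A B where
  toFun a := tmul a 1
  map_one' := one_def.symm
  map_mul' a a' := by rw [tmul_mul_tmul, one_mul]
  map_zero' := zero_tmul 1
  map_add' a a' := add_tmul a a' 1
  commutes' c := by
    rw [Algebra.algebraMap_eq_smul_one, Algebra.algebraMap_eq_smul_one, smul_tmul, one_def]
  map_star' a := by rw [star_tmul, star_one]

/-- The canonical embedding `b ↦ 1 ⊗ b`. -/
def includeRight : B →⋆ₐ[ℂ] MinTensor A B where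
  toFun b := tmul 1 b
  map_one' := one_def.symm
  map_mul' b b' := by rw [tmul_mul_tmul, one_mul]
  map_zero' := tmul_zero 1
  map_add' b b' := tmul_add 1 b b'
  commutes' c := by
    rw [Algebra.algebraMap_eq_smul_one, Algebra.algebraMap_eq_smul_one, tmul_smul, one_def]
  map_star' b := by rw [star_tmul, star_one]

theorem includeLeft_apply (a : A) : (includeLeft a : MinTensor A B) = tmul a 1 := rfl

theorem includeRight_apply (b : B) : (includeRight b : MinTensor A B) = tmul 1 b := rfl

theorem includeLeft_mul_includeRight (a : A) (b : B) :
    (includeLeft a * includeRight b : MinTensor A B) = tmul a b := by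
  rw [includeLeft_apply, includeRight_apply, tmul_mul_tmul, mul_one, one_mul]

theorem includeRight_mul_includeLeft (b : B) (a : A) :
    (includeRight b * includeLeft a : MinTensor A B) = tmul a b := by
  rw [includeLeft_apply, includeRight_apply, tmul_mul_tmul, mul_one, one_mul]

theorem commute_includeLeft_includeRight (a : A) (b : B) :
    Commute (includeLeft a : MinTensor A B) (includeRight b) :=
  (includeLeft_mul_includeRight a b).trans (includeRight_mul_includeLeft b a).symm

theorem induction_on {P : MinTensor A B → Prop} (x : MinTensor A B) (isClosed : IsClosed {x | P x})
    (tmul : ∀ a b, P (tmul a b)) (add : ∀ x y, P x → P y → P (x + y)) : P x := by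
  refine denseRange_ofAlg.induction_on x isClosed fun t => ?_
  induction t using TensorProduct.induction_on with
  | zero => simpa only [tmul_zero, map_zero] using tmul 0 0
  | tmul a b => exact tmul a b
  | add s t hs ht =>
    rw [map_add]
    exact add _ _ hs ht

theorem map_id (x : MinTensor A B) :
    map (NonUnitalStarAlgHom.id ℂ A) (NonUnitalStarAlgHom.id ℂ B) x = x := by
  induction x using induction_on with
  | isClosed => exact isClosed_eq (continuous_map _ _) continuous_id
  | tmul a b => exact map_tmul _ _ a b
  | add x y hx hy => rw [map_add, hx, hy]

theorem map_map (f' : C →⋆ₙₐ[ℂ] A') (g' : D →⋆ₙₐ[ℂ] B') (f : A →⋆ₙₐ[ℂ] C) (g : B →⋆ₙₐ[ℂ] D)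
    (x : MinTensor A B) : map f' g' (map f g x) = map (f'.comp f) (g'.comp g) x := by
  induction x using induction_on with
  | isClosed =>
    exact isClosed_eq ((continuous_map f' g').comp (continuous_map f g)) (continuous_map _ _)
  | tmul a b => simp only [map_tmul, NonUnitalStarAlgHom.comp_apply]
  | add x y hx hy => simp only [map_add, hx, hy]

theorem map_sum_left {ι : Type*} [Fintype ι] {f : A →⋆ₙₐ[ℂ] C} {F : ι → A →⋆ₙₐ[ℂ] C}
    (hf : ∀ a, f a = ∑ i, F i a) (g : B →⋆ₙₐ[ℂ] D) (x : MinTensor A B) :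
    map f g x = ∑ i, map (F i) g x := by
  induction x using induction_on with
  | isClosed =>
    exact isClosed_eq (continuous_map _ _) (continuous_finsetSum _ fun i _ => continuous_map _ _)
  | tmul a b => simp only [map_tmul, hf, sum_tmul]
  | add x y hx hy => simp only [map_add, hx, hy, Finset.sum_add_distrib]

theorem map_sum_right {ι : Type*} [Fintype ι] (f : A →⋆ₙₐ[ℂ] C) {g : B →⋆ₙₐ[ℂ] D}
    {G : ι → B →⋆ₙₐ[ℂ] D} (hg : ∀ b, g b = ∑ i, G i b) (x : MinTensor A B) :
    map f g x = ∑ i, map f (G i) x := by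
  induction x using induction_on with
  | isClosed =>
    exact isClosed_eq (continuous_map _ _) (continuous_finsetSum _ fun i _ => continuous_map _ _)
  | tmul a b => simp only [map_tmul, hg, tmul_sum]
  | add x y hx hy => simp only [map_add, hx, hy, Finset.sum_add_distrib]

theorem map_eq_zero_of_left {f : A →⋆ₙₐ[ℂ] C} {g : B →⋆ₙₐ[ℂ] D} {x : MinTensor A B}
    (hf : ∀ a, f a = 0) : map f g x = 0 := by
  rw [map_sum_left (F := fun i : Empty => i.elim) (fun a => hf a), Finset.univ_eq_empty,
    Finset.sum_empty]

theorem map_mul_includeLeft (f : A →⋆ₙₐ[ℂ] C) (g : B →⋆ₙₐ[ℂ] D) (x : MinTensor A B) (a : A) :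
    map f g x * includeLeft (f a) = map f g (x * includeLeft a) := by
  induction x using induction_on with
  | isClosed =>
    exact isClosed_eq ((continuous_map f g).mul continuous_const)
      ((continuous_map f g).comp (continuous_id.mul continuous_const))
  | tmul a' b =>
    simp only [includeLeft_apply, tmul_mul_tmul, map_tmul, map_mul, mul_one]
  | add x y hx hy => simp only [map_add, add_mul, hx, hy]

theorem map_mul_includeRight (f : A →⋆ₙₐ[ℂ] C) (g : B →⋆ₙₐ[ℂ] D) (x : MinTensor A B) (b : B) :
    map f g x * includeRight (g b) = map f g (x * includeRight b) := by
  induction x using induction_on with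
  | isClosed =>
    exact isClosed_eq ((continuous_map f g).mul continuous_const)
      ((continuous_map f g).comp (continuous_id.mul continuous_const))
  | tmul a b' =>
    simp only [includeRight_apply, tmul_mul_tmul, map_tmul, map_mul, mul_one]
  | add x y hx hy => simp only [map_add, add_mul, hx, hy]

theorem map_mul_includeLeft_eq_zero {f : A →⋆ₙₐ[ℂ] C} {c : C} (hc : ∀ a, f a * c = 0)
    (g : B →⋆ₙₐ[ℂ] D) (x : MinTensor A B) : map f g x * includeLeft c = 0 := by
  induction x using induction_on with
  | isClosed => exact isClosed_eq ((continuous_map f g).mul continuous_const) continuous_const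
  | tmul a b => rw [includeLeft_apply, map_tmul, tmul_mul_tmul, hc, zero_tmul]
  | add x y hx hy => rw [map_add, add_mul, hx, hy, add_zero]

theorem map_mul_includeRight_eq_zero {g : B →⋆ₙₐ[ℂ] D} {d : D} (hd : ∀ b, g b * d = 0)
    (f : A →⋆ₙₐ[ℂ] C) (x : MinTensor A B) : map f g x * includeRight d = 0 := by
  induction x using induction_on with
  | isClosed => exact isClosed_eq ((continuous_map f g).mul continuous_const) continuous_const
  | tmul a b => rw [includeRight_apply, map_tmul, tmul_mul_tmul, hd, tmul_zero]
  | add x y hx hy => rw [map_add, add_mul, hx, hy, add_zero]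

/-- The linear map `(a ⊗ b) ⊗ c ↦ ((a ⊗ b) ⊗ c, a ⊗ (b ⊗ c))`, the closure of whose range is the
graph of the associativity isomorphism. -/
def assocPair (A B C : Type u) [CStarAlgebra A] [CStarAlgebra B] [CStarAlgebra C] :
    (A ⊗[ℂ] B) ⊗[ℂ] C →ₗ[ℂ] MinTensor (MinTensor A B) C × MinTensor A (MinTensor B C) :=
  LinearMap.prod
    ((ofAlg : MinTensor A B ⊗[ℂ] C →⋆ₐ[ℂ] _).toAlgHom.toLinearMap ∘ₗ
      TensorProduct.map (ofAlg : A ⊗[ℂ] B →⋆ₐ[ℂ] _).toAlgHom.toLinearMap LinearMap.id)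
    ((ofAlg : A ⊗[ℂ] MinTensor B C →⋆ₐ[ℂ] _).toAlgHom.toLinearMap ∘ₗ
      TensorProduct.map LinearMap.id (ofAlg : B ⊗[ℂ] C →⋆ₐ[ℂ] _).toAlgHom.toLinearMap ∘ₗ
      (TensorProduct.assoc ℂ A B C).toLinearMap)

namespace AssocRel

variable {x x' : MinTensor (MinTensor A B) C} {y y' : MinTensor A (MinTensor B C)}

theorem iff_mem_topologicalClosure :
    AssocRel x y ↔ (x, y) ∈ (LinearMap.range (assocPair A B C)).topologicalClosure :=
  Iff.rfl

protected theorem tmul (a : A) (b : B) (c : C) :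
    AssocRel (tmul (tmul a b) c) (tmul a (tmul b c)) :=
  subset_closure ⟨(a ⊗ₜ b) ⊗ₜ c, rfl⟩

protected theorem add (h : AssocRel x y) (h' : AssocRel x' y') : AssocRel (x + x') (y + y') :=
  iff_mem_topologicalClosure.2 <|
    add_mem (iff_mem_topologicalClosure.1 h) (iff_mem_topologicalClosure.1 h')

protected theorem smul (c : ℂ) (h : AssocRel x y) : AssocRel (c • x) (c • y) :=
  iff_mem_topologicalClosure.2 <|
    Submodule.smul_mem _ c (iff_mem_topologicalClosure.1 h)

protected theorem sum {ι : Type*} {s : Finset ι} {x : ι → MinTensor (MinTensor A B) C}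
    {y : ι → MinTensor A (MinTensor B C)} (h : ∀ i ∈ s, AssocRel (x i) (y i)) :
    AssocRel (∑ i ∈ s, x i) (∑ i ∈ s, y i) := by
  have mem := sum_mem fun i hi => iff_mem_topologicalClosure.1 (h i hi)
  rwa [show ∑ i ∈ s, (x i, y i) = (∑ i ∈ s, x i, ∑ i ∈ s, y i) from
    Prod.ext Prod.fst_sum Prod.snd_sum] at mem

theorem isClosed_setOf {Y : Type*} [TopologicalSpace Y] {f : Y → MinTensor (MinTensor A B) C}
    {g : Y → MinTensor A (MinTensor B C)} (hf : Continuous f) (hg : Continuous g) :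
    IsClosed {y | AssocRel (f y) (g y)} :=
  isClosed_closure.preimage (hf.prodMk hg)

theorem induction {P : MinTensor (MinTensor A B) C → MinTensor A (MinTensor B C) → Prop}
    (isClosed : IsClosed {p : _ × _ | P p.1 p.2})
    (tmul : ∀ a b c, P (tmul (tmul a b) c) (tmul a (tmul b c)))
    (add : ∀ x x' y y', P x y → P x' y' → P (x + x') (y + y')) (h : AssocRel x y) : P x y := by
  have zero : P 0 0 := by simpa only [tmul_zero, zero_tmul] using tmul 0 0 0
  refine closure_minimal (Set.range_subset_iff.2 fun t => ?_) isClosed h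
  change P (assocPair A B C t).1 (assocPair A B C t).2
  induction t using TensorProduct.induction_on with
  | zero =>
    rw [map_zero]
    exact zero
  | add s t hs ht =>
    rw [map_add]
    exact add _ _ _ _ hs ht
  | tmul s c =>
    induction s using TensorProduct.induction_on with
    | zero =>
      rw [TensorProduct.zero_tmul, map_zero]
      exact zero
    | add s t hs ht =>
      rw [TensorProduct.add_tmul, map_add]
      exact add _ _ _ _ hs ht
    | tmul a b => exact tmul a b c

protected theorem mul (h : AssocRel x y) (h' : AssocRel x' y') : AssocRel (x * x') (y * y') := by
  refine h.induction (P := fun x y => AssocRel (x * x') (y * y'))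
    (isClosed_setOf (continuous_fst.mul continuous_const) (continuous_snd.mul continuous_const))
    (fun a b c => ?_) fun x₁ x₂ y₁ y₂ h₁ h₂ => ?_
  · refine h'.induction (P := fun x' y' => AssocRel (_ * x') (_ * y'))
      (isClosed_setOf (continuous_const.mul continuous_fst) (continuous_const.mul continuous_snd))
      (fun a' b' c' => ?_) fun x₁ x₂ y₁ y₂ h₁ h₂ => ?_
    · simpa only [tmul_mul_tmul] using AssocRel.tmul (a * a') (b * b') (c * c')
    · simpa only [mul_add] using h₁.add h₂
  · simpa only [add_mul] using h₁.add h₂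

protected theorem star (h : AssocRel x y) : AssocRel (star x) (star y) := by
  refine h.induction (P := fun x y => AssocRel (star x) (star y))
    (isClosed_setOf continuous_fst.star continuous_snd.star) (fun a b c => ?_)
    fun x₁ x₂ y₁ y₂ h₁ h₂ => ?_
  · simpa only [star_tmul] using AssocRel.tmul (star a) (star b) (star c)
  · simpa only [star_add] using h₁.add h₂

protected theorem map (f : A →⋆ₙₐ[ℂ] A') (g : B →⋆ₙₐ[ℂ] B') (h : C →⋆ₙₐ[ℂ] C')
    (hxy : AssocRel x y) : AssocRel (map (map f g) h x) (map f (map g h) y) := by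
  refine hxy.induction (P := fun x y => AssocRel (map (map f g) h x) (map f (map g h) y))
    (isClosed_setOf ((continuous_map _ _).comp continuous_fst)
      ((continuous_map _ _).comp continuous_snd)) (fun a b c => ?_)
    fun x₁ x₂ y₁ y₂ h₁ h₂ => ?_
  · simpa only [map_tmul] using AssocRel.tmul (f a) (g b) (h c)
  · simpa only [map_add] using h₁.add h₂

theorem of_generators {X : Type u} (R : CStarRelations X)
    (f : R.Univ →⋆ₙₐ[ℂ] MinTensor (MinTensor A B) C)
    (g : R.Univ →⋆ₙₐ[ℂ] MinTensor A (MinTensor B C)) (one : AssocRel (f 1) (g 1))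
    (gen : ∀ x, AssocRel (f (R.gen x)) (g (R.gen x))) (a : R.Univ) : AssocRel (f a) (g a) := by
  refine R.univ_induction (P := fun a => AssocRel (f a) (g a))
    (isClosed_setOf (map_continuous f) (map_continuous g)) one gen (fun x => ?_)
    (fun c a h => ?_) (fun a b ha hb => ?_) (fun a b ha hb => ?_) a
  · simpa only [map_star] using (gen x).star
  · simpa only [map_smul] using h.smul c
  · simpa only [map_mul] using ha.mul hb
  · simpa only [map_add] using ha.add hb

end AssocRel

end MinTensor

/-! ### Dense product spans -/

section ProductSpan

variable {A Q M : Type u} [CStarAlgebra A] [CStarAlgebra Q] [CStarAlgebra M]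

/-- The linear span of `f(A) g(Q)`. For `g` one of the two embeddings of `Q` into a tensor product,
these are the spans occurring in the density conditions for compact quantum groups and actions. -/
def productSpan (f : A →⋆ₐ[ℂ] M) (g : Q →⋆ₐ[ℂ] M) : Submodule ℂ M :=
  Submodule.span ℂ {x | ∃ a b, x = f a * g b}

variable {f : A →⋆ₐ[ℂ] M} {g : Q →⋆ₐ[ℂ] M}

theorem mul_mem_closure_productSpan (a : A) (b : Q) :
    f a * g b ∈ (productSpan f g).topologicalClosure :=
  Submodule.le_topologicalClosure _ (Submodule.subset_span ⟨a, b, rfl⟩)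

theorem map_mem_of_mem_closure_productSpan {N F : Type*} [NormedAddCommGroup N] [NormedSpace ℂ N]
    [FunLike F M N] [LinearMapClass F ℂ M N] {T : Submodule ℂ N} {L : F} (hL : Continuous L)
    (mem : ∀ a b, L (f a * g b) ∈ T.topologicalClosure) {y : M}
    (hy : y ∈ (productSpan f g).topologicalClosure) : L y ∈ T.topologicalClosure := by
  refine Submodule.topologicalClosure_minimal (t := T.topologicalClosure.comap (L : M →ₗ[ℂ] N)) _
    (Submodule.span_le.2 ?_) (T.isClosed_topologicalClosure.preimage hL) hy
  rintro _ ⟨a, b, rfl⟩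
  exact mem a b

theorem mul_mem_closure_productSpan_of_mem {y : M}
    (hy : y ∈ (productSpan f g).topologicalClosure) (b : Q) :
    y * g b ∈ (productSpan f g).topologicalClosure := by
  refine map_mem_of_mem_closure_productSpan (L := LinearMap.mulRight ℂ (g b))
    (continuous_mul_const _) (fun a b' => ?_) hy
  rw [LinearMap.mulRight_apply, mul_assoc, ← map_mul]
  exact mul_mem_closure_productSpan a _

theorem MinTensor.dense_of_tmul_mem {B : Type u} [CStarAlgebra B] {T : Submodule ℂ (MinTensor A B)}
    (tmul_mem : ∀ a b, tmul a b ∈ T.topologicalClosure) : Dense (T : Set (MinTensor A B)) := by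
  intro x
  change x ∈ T.topologicalClosure
  induction x using MinTensor.induction_on with
  | isClosed => exact T.isClosed_topologicalClosure
  | tmul a b => exact tmul_mem a b
  | add x y hx hy => exact add_mem hx hy

theorem mul_mem_closure_productSpan_of_eq_mul {h : A →⋆ₐ[ℂ] M} {c : A} {u : Q}
    (hc : h c = f c * g u) (comm : ∀ b, Commute (h c) (g b)) {y : M}
    (hy : y ∈ (productSpan f g).topologicalClosure) :
    y * h c ∈ (productSpan f g).topologicalClosure := by
  refine map_mem_of_mem_closure_productSpan (L := LinearMap.mulRight ℂ (h c))
    (continuous_mul_const _) (fun a b => ?_) hy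
  rw [LinearMap.mulRight_apply, mul_assoc, ← comm b, hc, mul_assoc, ← mul_assoc, ← map_mul,
    ← map_mul]
  exact mul_mem_closure_productSpan _ _

theorem CStarRelations.mem_closure_productSpan {X : Type u} {R : CStarRelations X}
    {h f : R.Univ →⋆ₐ[ℂ] M} (comm : ∀ a b, Commute (h a) (g b))
    (gen : ∀ x, ∃ u ∈ unitary Q, f (R.gen x) = h (R.gen x) * g u) (a : R.Univ) :
    h a ∈ (productSpan f g).topologicalClosure := by
  -- Stability under right multiplication passes to products, which membership itself does not.
  suffices stable : ∀ y ∈ (productSpan f g).topologicalClosure,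
      y * h a ∈ (productSpan f g).topologicalClosure by
    have one_mem := mul_mem_closure_productSpan (f := f) (g := g) 1 1
    rw [map_one, map_one, one_mul] at one_mem
    simpa only [one_mul] using stable 1 one_mem
  induction a using R.univ_induction with
  | isClosed =>
    simp only [Set.ofPred_forall]
    exact isClosed_iInter fun y => isClosed_iInter fun _ =>
      (productSpan f g).isClosed_topologicalClosure.preimage
        ((continuous_const_mul y).comp (map_continuous h))
  | one => simp only [map_one, mul_one, imp_self, implies_true]
  | gen x =>
    obtain ⟨u, hu, hx⟩ := gen x
    refine fun y => mul_mem_closure_productSpan_of_eq_mul (u := star u) ?_ (comm _)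
    rw [hx, mul_assoc, ← map_mul, Unitary.mul_star_self_of_mem hu, map_one, mul_one]
  | star_gen x =>
    obtain ⟨u, hu, hx⟩ := gen x
    refine fun y => mul_mem_closure_productSpan_of_eq_mul (u := u) ?_ (comm _)
    rw [map_star f, hx, (comm _ _).eq, star_mul, ← map_star, ← map_star, mul_assoc, ← map_mul,
      Unitary.star_mul_self_of_mem hu, map_one, mul_one]
  | smul c a ha =>
    intro y hy
    rw [map_smul, mul_smul_comm]
    exact Submodule.smul_mem _ c (ha y hy)
  | mul a b ha hb =>
    intro y hy
    rw [map_mul, ← mul_assoc]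
    exact hb _ (ha y hy)
  | add a b ha hb =>
    intro y hy
    rw [map_add, mul_add]
    exact add_mem (ha y hy) (hb y hy)

end ProductSpan

/-! ### Doublings -/

/-- The power `φ^i` of an endomorphism `φ`, for an exponent `i` in the group `Bool` of order two. -/
def boolPow {A : Type u} [CStarAlgebra A] (φ : A →⋆ₐ[ℂ] A) : Bool → (A →⋆ₐ[ℂ] A)
  | false => StarAlgHom.id ℂ A
  | true => φ

section BoolPow

variable {A : Type u} [CStarAlgebra A]

theorem boolPow_boolPow {φ : A →⋆ₐ[ℂ] A} (hφ : ∀ a, φ (φ a) = a) (i j : Bool) (a : A) :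
    boolPow φ i (boolPow φ j a) = boolPow φ (i ^^ j) a := by
  cases i <;> cases j
  · rfl
  · rfl
  · rfl
  · exact hφ a

theorem boolPow_boolPow_self {φ : A →⋆ₐ[ℂ] A} (hφ : ∀ a, φ (φ a) = a) (i : Bool) (a : A) :
    boolPow φ i (boolPow φ i a) = a := by
  rw [boolPow_boolPow hφ, Bool.xor_self]
  rfl

theorem IsCQGMorphism.boolPow {Δ : A →⋆ₐ[ℂ] MinTensor A A} {φ : A →⋆ₐ[ℂ] A}
    (hφ : IsCQGMorphism Δ Δ φ) (i : Bool) : IsCQGMorphism Δ Δ (boolPow φ i) := by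
  cases i
  · intro a
    exact MinTensor.map_id (Δ a)
  · exact hφ

end BoolPow

section DoublingEmb

variable {Q : Type u} [CStarAlgebra Q]

theorem exists_eq_sum_doublingEmb (q : Q × Q) :
    ∃ c : Bool → Q, q = ∑ k, doublingEmb Q k (c k) := by
  refine ⟨fun k => bif k then q.2 else q.1, ?_⟩
  rw [Fintype.sum_bool]
  change q = (0 + q.1, q.2 + 0)
  rw [zero_add, add_zero]

theorem sum_doublingEmb (a : Q) : ∑ k, doublingEmb Q k a = (a, a) := by
  rw [Fintype.sum_bool]
  change (0 + a, a + 0) = (a, a)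
  rw [zero_add, add_zero]

/-- The homomorphism `ε_k φ^i`, where `ε_false = ζ` and `ε_true = η`. -/
def twistedEmb (φ : Q →⋆ₐ[ℂ] Q) (k i : Bool) : Q →⋆ₙₐ[ℂ] Q × Q :=
  (doublingEmb Q k).comp (boolPow φ i : Q →⋆ₙₐ[ℂ] Q)

theorem twistedEmb_apply (φ : Q →⋆ₐ[ℂ] Q) (k i : Bool) (a : Q) :
    twistedEmb φ k i a = doublingEmb Q k (boolPow φ i a) := rfl

end DoublingEmb

section Doubling

variable {Q : Type u} [CStarAlgebra Q] {Δ : Q →⋆ₐ[ℂ] MinTensor Q Q} {φ : Q →⋆ₐ[ℂ] Q}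

open MinTensor

theorem doublingComul_doublingEmb (Δ : Q →⋆ₐ[ℂ] MinTensor Q Q) (φ : Q →⋆ₐ[ℂ] Q) (k : Bool) (a : Q) :
    doublingComul Δ φ (doublingEmb Q k a) =
      ∑ i, map (doublingEmb Q i) (twistedEmb φ (k ^^ i) i) (Δ a) := by
  rw [Fintype.sum_bool, add_comm]
  cases k
  · exact doublingComul_zeta Δ φ a
  · exact doublingComul_eta Δ φ a

theorem map_comul_id_doublingComul (k : Bool) (a : Q) :
    map (doublingComul Δ φ : Q × Q →⋆ₙₐ[ℂ] _) (NonUnitalStarAlgHom.id ℂ _)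
        (doublingComul Δ φ (doublingEmb Q k a)) =
      ∑ i, ∑ j, map (map (doublingEmb Q j) (twistedEmb φ (i ^^ j) j)) (twistedEmb φ (k ^^ i) i)
        (map (Δ : Q →⋆ₙₐ[ℂ] _) (NonUnitalStarAlgHom.id ℂ Q) (Δ a)) := by
  rw [doublingComul_doublingEmb, map_sum]
  refine Finset.sum_congr rfl fun i _ => ?_
  rw [map_map, map_sum_left (F := fun j => (map (doublingEmb Q j)
    (twistedEmb φ (i ^^ j) j)).comp (Δ : Q →⋆ₙₐ[ℂ] _)) (doublingComul_doublingEmb Δ φ i)]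
  exact Finset.sum_congr rfl fun j _ => by rw [map_map]; rfl

theorem map_id_comul_doublingComul (hφ : ∀ a, φ (φ a) = a) (hφΔ : IsCQGMorphism Δ Δ φ)
    (k : Bool) (a : Q) :
    map (NonUnitalStarAlgHom.id ℂ _) (doublingComul Δ φ : Q × Q →⋆ₙₐ[ℂ] _)
        (doublingComul Δ φ (doublingEmb Q k a)) =
      ∑ i, ∑ j, map (doublingEmb Q i) (map (twistedEmb φ j i) (twistedEmb φ (k ^^ i ^^ j) (i ^^ j)))
        (map (NonUnitalStarAlgHom.id ℂ Q) (Δ : Q →⋆ₙₐ[ℂ] _) (Δ a)) := by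
  rw [doublingComul_doublingEmb, map_sum]
  refine Finset.sum_congr rfl fun i _ => ?_
  rw [map_map, map_sum_right (G := fun j => (map (twistedEmb φ j i)
    (twistedEmb φ (k ^^ i ^^ j) (i ^^ j))).comp (Δ : Q →⋆ₙₐ[ℂ] _))]
  · exact Finset.sum_congr rfl fun j _ => by rw [map_map]; rfl
  · intro b
    change doublingComul Δ φ (doublingEmb Q (k ^^ i) (boolPow φ i b)) = _
    rw [doublingComul_doublingEmb]
    refine Finset.sum_congr rfl fun j _ => ?_
    rw [← hφΔ.boolPow i b, map_map]
    refine congrArg (fun f => map _ f (Δ b)) (NonUnitalStarAlgHom.ext fun c => ?_)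
    simp only [NonUnitalStarAlgHom.comp_apply, twistedEmb_apply]
    exact congrArg _ ((boolPow_boolPow hφ j i c).trans (by rw [Bool.xor_comm]))

theorem doublingComul_coassoc (hΔ : IsCompactQuantumGroup Δ) (hφ : ∀ a, φ (φ a) = a)
    (hφΔ : IsCQGMorphism Δ Δ φ) (q : Q × Q) : AssocRel
      (map (doublingComul Δ φ : Q × Q →⋆ₙₐ[ℂ] MinTensor (Q × Q) (Q × Q))
        (NonUnitalStarAlgHom.id ℂ (Q × Q)) (doublingComul Δ φ q))
      (map (NonUnitalStarAlgHom.id ℂ (Q × Q))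
        (doublingComul Δ φ : Q × Q →⋆ₙₐ[ℂ] MinTensor (Q × Q) (Q × Q)) (doublingComul Δ φ q)) := by
  obtain ⟨c, rfl⟩ := exists_eq_sum_doublingEmb q
  simp only [map_sum]
  refine AssocRel.sum fun k _ => ?_
  rw [map_comul_id_doublingComul, map_id_comul_doublingComul hφ hφΔ, Finset.sum_comm]
  refine AssocRel.sum fun j _ => ?_
  have involutive : Function.Involutive (j ^^ ·) := fun i => by simp
  rw [← Equiv.sum_comp involutive.toPerm]
  refine AssocRel.sum fun i _ => ?_
  change AssocRel (map (map _ (twistedEmb φ (j ^^ i ^^ j) j)) _ _) _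
  rw [Bool.xor_right_comm, Bool.xor_self, Bool.false_xor, Bool.xor_assoc]
  exact (hΔ.coassoc (c k)).map _ _ _

theorem dense_productSpan_doublingComul {g : Q →⋆ₐ[ℂ] MinTensor Q Q}
    {g' : Q × Q →⋆ₐ[ℂ] MinTensor (Q × Q) (Q × Q)}
    (hg : ∀ i j b, ∃ c, ∀ a, doublingComul Δ φ (doublingEmb Q (j ^^ i) a) * g' c =
      map (doublingEmb Q i) (twistedEmb φ j i) (Δ a * g b))
    (hφ : ∀ a, φ (φ a) = a) (dense : Dense (productSpan Δ g : Set (MinTensor Q Q))) :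
    Dense (productSpan (doublingComul Δ φ) g' : Set (MinTensor (Q × Q) (Q × Q))) := by
  refine dense_of_tmul_mem fun p q => ?_
  obtain ⟨a, rfl⟩ := exists_eq_sum_doublingEmb p
  obtain ⟨b, rfl⟩ := exists_eq_sum_doublingEmb q
  simp only [sum_tmul, tmul_sum]
  refine sum_mem fun i _ => sum_mem fun j _ => ?_
  rw [← boolPow_boolPow_self hφ j (b i), ← twistedEmb_apply, ← map_tmul]
  refine map_mem_of_mem_closure_productSpan (continuous_map _ _) (fun c d => ?_) (dense _)
  obtain ⟨e, he⟩ := hg j i d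
  exact he c ▸ mul_mem_closure_productSpan _ e

theorem doublingComul_mul_includeRight (i j : Bool) (a b : Q) :
    doublingComul Δ φ (doublingEmb Q (j ^^ i) a) * includeRight (twistedEmb φ j i b) =
      map (doublingEmb Q i) (twistedEmb φ j i) (Δ a * includeRight b) := by
  rw [doublingComul_doublingEmb, Finset.sum_mul, Finset.sum_eq_single i]
  · rw [Bool.xor_assoc, Bool.xor_self, Bool.xor_false, map_mul_includeRight]
  · intro l _ hl
    refine map_mul_includeRight_eq_zero (fun _ => doublingEmb_mul (fun h => hl ?_) _ _) _ _
    rw [Bool.xor_assoc] at h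
    have xor_eq_false : (i ^^ l) = false := Bool.xor_right_inj.1 (h.trans (Bool.xor_false j).symm)
    exact (Bool.xor_left_inj.1 (xor_eq_false.trans (Bool.xor_self l).symm)).symm
  · exact fun h => absurd (Finset.mem_univ i) h

theorem doublingComul_mul_includeLeft (i j : Bool) (a b : Q) :
    doublingComul Δ φ (doublingEmb Q (j ^^ i) a) * includeLeft (doublingEmb Q i b) =
      map (doublingEmb Q i) (twistedEmb φ j i) (Δ a * includeLeft b) := by
  rw [doublingComul_doublingEmb, Finset.sum_mul, Finset.sum_eq_single i]
  · rw [Bool.xor_assoc, Bool.xor_self, Bool.xor_false, map_mul_includeLeft]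
  · exact fun l _ hl => map_mul_includeLeft_eq_zero (fun _ => doublingEmb_mul hl _ _) _ _
  · exact fun h => absurd (Finset.mem_univ i) h

theorem IsCompactQuantumGroup.doubling (hΔ : IsCompactQuantumGroup Δ) (hφ : ∀ a, φ (φ a) = a)
    (hφΔ : IsCQGMorphism Δ Δ φ) : IsCompactQuantumGroup (doublingComul Δ φ) where
  coassoc := doublingComul_coassoc hΔ hφ hφΔ
  dense_right := dense_productSpan_doublingComul (g := includeRight) (g' := includeRight)
    (fun i j b => ⟨_, fun a => doublingComul_mul_includeRight i j a b⟩) hφ hΔ.dense_right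
  dense_left := dense_productSpan_doublingComul (g := includeLeft) (g' := includeLeft)
    (fun i j b => ⟨_, fun a => doublingComul_mul_includeLeft i j a b⟩) hφ hΔ.dense_left

end Doubling

section DoubledAction

variable {C Q : Type u} [CStarAlgebra C] [CStarAlgebra Q]

open MinTensor

/-- The homomorphism `(id ⊗ ζ) α + (id ⊗ η) α θ` into `C ⊗ (Q ⊕ Q)`. If `α` is an action of a
compact quantum group and `α θ = (θ ⊗ φ) α` for involutions `θ` of `C` and `φ` of `Q`, then it is an
action of the doubling by `φ`. -/
def doubledAction (α : C →⋆ₐ[ℂ] MinTensor C Q) (θ : C →⋆ₐ[ℂ] C) :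
    C →⋆ₐ[ℂ] MinTensor C (Q × Q) :=
  let F (i : Bool) : C →⋆ₙₐ[ℂ] MinTensor C (Q × Q) :=
    (map (NonUnitalStarAlgHom.id ℂ C) (doublingEmb Q i)).comp (α.comp (boolPow θ i) : C →⋆ₙₐ[ℂ] _)
  have map_one : ∑ i, F i 1 = 1 := by
    have F_one (i : Bool) : F i 1 = tmul 1 (doublingEmb Q i 1) := by
      change map _ _ (α (boolPow θ i 1)) = _
      rw [map_one, map_one, one_def, map_tmul]
      rfl
    simp only [F_one, ← tmul_sum, sum_doublingEmb]
    exact one_def.symm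
  { toFun := fun x => ∑ i, F i x
    map_one' := map_one
    map_mul' := fun x y => by
      simp only [Finset.sum_mul_sum, map_mul]
      refine Finset.sum_congr rfl fun i _ => ?_
      rw [Finset.sum_eq_single i]
      · intro j _ hij
        exact map_mul_map_eq_zero _ _ _ _ (Or.inr fun b b' => doublingEmb_mul hij.symm b b') _ _
      · exact fun h => absurd (Finset.mem_univ i) h
    map_zero' := by simp only [map_zero, Finset.sum_const_zero]
    map_add' := fun x y => by simp only [map_add, Finset.sum_add_distrib]
    commutes' := fun c => by
      simp only [Algebra.algebraMap_eq_smul_one, map_smul, ← Finset.smul_sum, map_one]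
    map_star' := fun x => by simp only [map_star, star_sum] }

variable {Δ : Q →⋆ₐ[ℂ] MinTensor Q Q} {φ : Q →⋆ₐ[ℂ] Q} {α : C →⋆ₐ[ℂ] MinTensor C Q}
  {θ : C →⋆ₐ[ℂ] C}

theorem doubledAction_apply (x : C) : doubledAction α θ x =
    ∑ i, map (NonUnitalStarAlgHom.id ℂ C) (doublingEmb Q i) (α (boolPow θ i x)) := rfl

theorem dense_productSpan_doubledAction (hθ : ∀ x, θ (θ x) = x)
    (dense : Dense (productSpan α includeRight : Set (MinTensor C Q))) :
    Dense (productSpan (doubledAction α θ) includeRight : Set (MinTensor C (Q × Q))) := by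
  refine dense_of_tmul_mem fun x q => ?_
  obtain ⟨b, rfl⟩ := exists_eq_sum_doublingEmb q
  rw [tmul_sum]
  refine sum_mem fun i _ => ?_
  change tmul (NonUnitalStarAlgHom.id ℂ C x) _ ∈ _
  rw [← map_tmul]
  refine map_mem_of_mem_closure_productSpan (continuous_map _ _) (fun y d => ?_) (dense _)
  suffices map (NonUnitalStarAlgHom.id ℂ C) (doublingEmb Q i) (α y * includeRight d) =
      doubledAction α θ (boolPow θ i y) * includeRight (doublingEmb Q i d) from
    this ▸ mul_mem_closure_productSpan _ _
  rw [doubledAction_apply, Finset.sum_mul, Finset.sum_eq_single i, boolPow_boolPow_self hθ,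
    map_mul_includeRight]
  · exact fun j _ hj => map_mul_includeRight_eq_zero (fun _ => doublingEmb_mul hj _ _) _ _
  · exact fun h => absurd (Finset.mem_univ i) h

theorem map_boolPow_apply_boolPow (hθ : ∀ x, θ (θ x) = x)
    (hαθ : ∀ x, map (θ : C →⋆ₙₐ[ℂ] C) (φ : Q →⋆ₙₐ[ℂ] Q) (α x) = α (θ x)) (i j : Bool) (x : C) :
    map (boolPow θ j : C →⋆ₙₐ[ℂ] C) (NonUnitalStarAlgHom.id ℂ Q) (α (boolPow θ i x)) =
      map (NonUnitalStarAlgHom.id ℂ C) (boolPow φ j : Q →⋆ₙₐ[ℂ] Q) (α (boolPow θ (i ^^ j) x)) := by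
  cases j
  · rw [Bool.xor_false]
    rfl
  · have key := hαθ (boolPow θ (i ^^ true) x)
    have pow_succ : θ (boolPow θ (i ^^ true) x) = boolPow θ i x := by
      cases i
      · exact hθ x
      · rfl
    rw [pow_succ] at key
    rw [← key, map_map]
    refine congrArg (fun f => map f _ _) (NonUnitalStarAlgHom.ext fun y => ?_)
    exact hθ y

theorem map_doubledAction_id_doubledAction (hθ : ∀ x, θ (θ x) = x)
    (hαθ : ∀ x, map (θ : C →⋆ₙₐ[ℂ] C) (φ : Q →⋆ₙₐ[ℂ] Q) (α x) = α (θ x)) (x : C) :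
    map (doubledAction α θ : C →⋆ₙₐ[ℂ] _) (NonUnitalStarAlgHom.id ℂ (Q × Q))
        (doubledAction α θ x) =
      ∑ i, ∑ j, map (map (NonUnitalStarAlgHom.id ℂ C) (doublingEmb Q j)) (twistedEmb φ i j)
        (map (α : C →⋆ₙₐ[ℂ] _) (NonUnitalStarAlgHom.id ℂ Q) (α (boolPow θ (i ^^ j) x))) := by
  rw [doubledAction_apply, map_sum]
  refine Finset.sum_congr rfl fun i _ => ?_
  rw [map_map, map_sum_left (F := fun j => (map (NonUnitalStarAlgHom.id ℂ C)
    (doublingEmb Q j)).comp ((α.comp (boolPow θ j) : C →⋆ₐ[ℂ] _) : C →⋆ₙₐ[ℂ] _))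
    (fun y => doubledAction_apply y)]
  refine Finset.sum_congr rfl fun j _ => ?_
  have split (y : MinTensor C Q) : map ((map (NonUnitalStarAlgHom.id ℂ C) (doublingEmb Q j)).comp
      ((α.comp (boolPow θ j) : C →⋆ₐ[ℂ] _) : C →⋆ₙₐ[ℂ] _)) (doublingEmb Q i) y =
      map ((map (NonUnitalStarAlgHom.id ℂ C) (doublingEmb Q j)).comp (α : C →⋆ₙₐ[ℂ] _))
        (doublingEmb Q i) (map (boolPow θ j : C →⋆ₙₐ[ℂ] C) (NonUnitalStarAlgHom.id ℂ Q) y) := by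
    rw [map_map]
    rfl
  exact (split _).trans (by rw [map_boolPow_apply_boolPow hθ hαθ, map_map, map_map]; rfl)

theorem map_id_comul_doubledAction (x : C) :
    map (NonUnitalStarAlgHom.id ℂ C) (doublingComul Δ φ : Q × Q →⋆ₙₐ[ℂ] _)
        (doubledAction α θ x) =
      ∑ k, ∑ j, map (NonUnitalStarAlgHom.id ℂ C) (map (doublingEmb Q j) (twistedEmb φ (k ^^ j) j))
        (map (NonUnitalStarAlgHom.id ℂ C) (Δ : Q →⋆ₙₐ[ℂ] _) (α (boolPow θ k x))) := by
  rw [doubledAction_apply, map_sum]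
  refine Finset.sum_congr rfl fun k _ => ?_
  rw [map_map, map_sum_right (G := fun j => (map (doublingEmb Q j)
    (twistedEmb φ (k ^^ j) j)).comp (Δ : Q →⋆ₙₐ[ℂ] _)) _ (doublingComul_doublingEmb Δ φ k)]
  exact Finset.sum_congr rfl fun j _ => by rw [map_map]

theorem doubledAction_coaction
    (hα : ∀ x, AssocRel (map (α : C →⋆ₙₐ[ℂ] MinTensor C Q) (NonUnitalStarAlgHom.id ℂ Q) (α x))
      (map (NonUnitalStarAlgHom.id ℂ C) (Δ : Q →⋆ₙₐ[ℂ] MinTensor Q Q) (α x)))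
    (hθ : ∀ x, θ (θ x) = x)
    (hαθ : ∀ x, map (θ : C →⋆ₙₐ[ℂ] C) (φ : Q →⋆ₙₐ[ℂ] Q) (α x) = α (θ x)) (x : C) : AssocRel
      (map (doubledAction α θ : C →⋆ₙₐ[ℂ] MinTensor C (Q × Q)) (NonUnitalStarAlgHom.id ℂ (Q × Q))
        (doubledAction α θ x))
      (map (NonUnitalStarAlgHom.id ℂ C)
        (doublingComul Δ φ : Q × Q →⋆ₙₐ[ℂ] MinTensor (Q × Q) (Q × Q)) (doubledAction α θ x)) := by
  rw [map_doubledAction_id_doubledAction hθ hαθ, map_id_comul_doubledAction, Finset.sum_comm,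
    Finset.sum_comm (γ := Bool) (f := fun k j => map _ (map (doublingEmb Q j) _) _)]
  refine AssocRel.sum fun j _ => ?_
  have involutive : Function.Involutive (· ^^ j) := fun i => by simp
  rw [← Equiv.sum_comp involutive.toPerm (fun k => map _ (map (doublingEmb Q j) _) _)]
  refine AssocRel.sum fun i _ => ?_
  change AssocRel _ (map _ (map _ (twistedEmb φ (i ^^ j ^^ j) j)) _)
  rw [Bool.xor_assoc, Bool.xor_self, Bool.xor_false]
  exact (hα _).map _ _ _

end DoubledAction

/-! ### Cuntz–Krieger families and the functional `τ` -/

theorem eq_zero_of_sum_star_mul_self_eq_zero {A ι : Type*} [CStarAlgebra A] {s : Finset ι}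
    {a : ι → A} (h : ∑ i ∈ s, star (a i) * a i = 0) {i : ι} (hi : i ∈ s) : a i = 0 := by
  let := CStarAlgebra.spectralOrder A
  have := CStarAlgebra.spectralOrderedRing A
  have star_mul_self := (Finset.sum_eq_zero_iff_of_nonneg fun i _ => star_mul_self_nonneg (a i)).1 h
  exact (CStarRing.star_mul_self_eq_zero_iff _).1 (star_mul_self i hi)

namespace DirectedGraph

variable {V E : Type u} [Fintype V] [Fintype E] {Γ : DirectedGraph V E}

namespace IsCKFamily

variable {B : Type u} [CStarAlgebra B] {p : V → B} {S : E → B}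

theorem p_mul_self (h : Γ.IsCKFamily p S) (v : V) : p v * p v = p v :=
  (h.p_mul_p v v).trans (if_pos rfl)

theorem S_mul_p (h : Γ.IsCKFamily p S) (e : E) : S e * p (Γ.r e) = S e := by
  rw [← h.star_S_mul_S, ← mul_assoc, h.partialIsometry]

theorem p_mul_S (h : Γ.IsCKFamily p S) (e : E) : p (Γ.s e) * S e = S e := by
  classical
  set q := p (Γ.s e)
  have star_compl : star (1 - q) = 1 - q := by rw [star_sub, star_one, h.star_p]
  have sum_eq_zero : ∑ f ∈ Finset.univ.filter (Γ.s · = Γ.s e),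
      star (star (S f) * (1 - q)) * (star (S f) * (1 - q)) = 0 := by
    have term (f : E) : star (star (S f) * (1 - q)) * (star (S f) * (1 - q)) =
        (1 - q) * (S f * star (S f)) * (1 - q) := by
      simp only [star_mul, star_star, star_compl, mul_assoc]
    simp only [term]
    rw [← Finset.sum_mul, ← Finset.mul_sum]
    convert (congrArg (fun x => (1 - q) * x * (1 - q)) (h.sum_S_mul_star _ ⟨e, rfl⟩)).symm.trans ?_
    rw [sub_mul, one_mul, h.p_mul_self, sub_self, zero_mul]
  have vanish := eq_zero_of_sum_star_mul_self_eq_zero sum_eq_zero (i := e)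
    (Finset.mem_filter.2 ⟨Finset.mem_univ e, rfl⟩)
  have vanish_star := congrArg star vanish
  rw [star_mul, star_star, star_compl, star_zero, sub_mul, one_mul, sub_eq_zero] at vanish_star
  exact vanish_star.symm

theorem p_mul_S_of_ne (h : Γ.IsCKFamily p S) {u : V} {e : E} (hu : Γ.s e ≠ u) : p u * S e = 0 := by
  classical
  rw [← h.p_mul_S e, ← mul_assoc, h.p_mul_p, if_neg hu.symm, zero_mul]

theorem star_S_mul_S_of_ne (h : Γ.IsCKFamily p S) {e f : E} (hef : e ≠ f) :
    star (S e) * S f = 0 := by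
  classical
  by_cases hs : Γ.s e = Γ.s f
  · have sum_eq : ∑ g ∈ Finset.univ.filter (Γ.s · = Γ.s f),
        star (star (S g) * S f) * (star (S g) * S f) = p (Γ.r f) := by
      have term (g : E) : star (star (S g) * S f) * (star (S g) * S f) =
          star (S f) * (S g * star (S g)) * S f := by
        simp only [star_mul, star_star, mul_assoc]
      simp only [term]
      rw [← Finset.sum_mul, ← Finset.mul_sum]
      convert (congrArg (star (S f) * · * S f) (h.sum_S_mul_star _ ⟨f, rfl⟩)).symm.trans ?_
      rw [mul_assoc, h.p_mul_S, h.star_S_mul_S]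
    have diagonal : star (star (S f) * S f) * (star (S f) * S f) = p (Γ.r f) := by
      rw [h.star_S_mul_S, h.star_p, h.p_mul_self]
    have mem {g : E} (hg : Γ.s g = Γ.s f) : g ∈ Finset.univ.filter (Γ.s · = Γ.s f) :=
      Finset.mem_filter.2 ⟨Finset.mem_univ g, hg⟩
    rw [← Finset.add_sum_erase _ _ (mem rfl), diagonal, add_eq_left] at sum_eq
    exact eq_zero_of_sum_star_mul_self_eq_zero sum_eq (Finset.mem_erase.2 ⟨hef, mem hs⟩)
  · rw [← h.p_mul_S f, ← mul_assoc, ← h.star_p (Γ.s f), ← star_mul, h.p_mul_S_of_ne hs, star_zero,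
      zero_mul]

open Classical in
theorem star_S_mul_S_eq_ite (h : Γ.IsCKFamily p S) (e f : E) :
    star (S e) * S f = if e = f then p (Γ.r e) else 0 := by
  split_ifs with hef
  · rw [← hef, h.star_S_mul_S]
  · exact h.star_S_mul_S_of_ne hef

theorem S_mul_star_S_of_ne (h : Γ.IsCKFamily p S) {e f : E} (hef : Γ.r e ≠ Γ.r f) :
    S e * star (S f) = 0 := by
  classical
  rw [← h.S_mul_p e, ← h.S_mul_p f, star_mul, h.star_p, mul_assoc, ← mul_assoc (p _), h.p_mul_p,
    if_neg hef, zero_mul, mul_zero]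

open Classical in
theorem comp_perm (h : Γ.IsCKFamily p S) {σ : Equiv.Perm E} (hs : ∀ e, Γ.s (σ e) = Γ.s e)
    (hr : ∀ e, Γ.r (σ e) = Γ.r e) : Γ.IsCKFamily p (S ∘ σ) where
  star_p := h.star_p
  p_mul_p := h.p_mul_p
  sum_p := h.sum_p
  partialIsometry e := h.partialIsometry (σ e)
  star_S_mul_S e := (h.star_S_mul_S (σ e)).trans (congrArg p (hr e))
  sum_S_mul_star v hv := (h.sum_S_mul_star v hv).trans <|
    (Finset.sum_equiv σ (fun e => by simp only [Finset.mem_filter_univ, hs]) fun _ _ => rfl).symm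

theorem tmul_unitary {Q : Type u} [CStarAlgebra Q] (h : Γ.IsCKFamily p S) (u : E → unitary Q) :
    Γ.IsCKFamily (fun v => (MinTensor.tmul (p v) 1 : MinTensor B Q))
      (fun e => MinTensor.tmul (S e) (u e : Q)) where
  star_p v := by rw [MinTensor.star_tmul, h.star_p, star_one]
  p_mul_p v w := by
    rw [MinTensor.tmul_mul_tmul, h.p_mul_p, one_mul]
    split_ifs
    · rfl
    · exact MinTensor.zero_tmul 1
  sum_p := by rw [← MinTensor.sum_tmul, h.sum_p, MinTensor.one_def]
  partialIsometry e := by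
    rw [MinTensor.star_tmul, MinTensor.tmul_mul_tmul, MinTensor.tmul_mul_tmul, h.partialIsometry,
      Unitary.mul_star_self_of_mem (u e).2, one_mul]
  star_S_mul_S e := by
    rw [MinTensor.star_tmul, MinTensor.tmul_mul_tmul, h.star_S_mul_S,
      Unitary.star_mul_self_of_mem (u e).2]
  sum_S_mul_star v hv := by
    simp only [MinTensor.star_tmul, MinTensor.tmul_mul_tmul, Unitary.mul_star_self_of_mem (u _).2]
    rw [← MinTensor.sum_tmul, ← h.sum_S_mul_star v hv]

end IsCKFamily

end DirectedGraph

open Classical in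
/-- A Cuntz family: isometries with mutually orthogonal ranges that add up to the whole space. -/
structure IsCuntzFamily {ι B : Type*} [Fintype ι] [CStarAlgebra B] (T : ι → B) : Prop where
  star_mul : ∀ i j, star (T i) * T j = if i = j then 1 else 0
  sum_mul_star : ∑ i, T i * star (T i) = 1

theorem IsCuntzFamily.star_mul_self {ι B : Type*} [Fintype ι] [CStarAlgebra B] {T : ι → B}
    (h : IsCuntzFamily T) (i : ι) : star (T i) * T i = 1 :=
  (h.star_mul i i).trans (if_pos rfl)

section CuntzFamily

variable {H : Type*} [NormedAddCommGroup H] [InnerProductSpace ℂ H] {N ι : Type*}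

theorem clm_ext_hilbertBasis (b : HilbertBasis N ℂ H) {f g : H →L[ℂ] H}
    (h : ∀ n, f (b n) = g (b n)) : f = g := by
  refine ContinuousLinearMap.ext_on (s := Set.range b) ?_ (Set.forall_mem_range.2 h)
  exact (Submodule.dense_iff_topologicalClosure_eq_top).2 b.dense_span

variable [CompleteSpace H]

theorem exists_clm_hilbertBasis_apply (b : HilbertBasis N ℂ H) {v : N → H} (hv : Orthonormal ℂ v) :
    ∃ T : H →L[ℂ] H, ∀ n, T (b n) = v n := by
  classical
  refine ⟨(hv.orthogonalFamily.linearIsometry.comp b.repr.toLinearIsometry).toContinuousLinearMap,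
    fun n => ?_⟩
  change hv.orthogonalFamily.linearIsometry (b.repr (b n)) = v n
  rw [b.repr_self, OrthogonalFamily.linearIsometry_apply_single]
  exact one_smul ℂ (v n)

open Classical in
theorem exists_isCuntzFamily (b : HilbertBasis N ℂ H) [Fintype ι] (β : ι × N ≃ N) :
    ∃ T : ι → (H →L[ℂ] H), IsCuntzFamily T := by
  have orthonormal (i : ι) : Orthonormal ℂ fun n => b (β (i, n)) :=
    b.orthonormal.comp _ (β.injective.comp (Prod.mk_right_injective i))
  choose T hT using fun i => exists_clm_hilbertBasis_apply b (orthonormal i)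
  have star_T_apply (i j : ι) (n : N) : star (T i) (b (β (j, n))) = if i = j then b n else 0 := by
    refine b.repr.injective (lp.ext (funext fun m => ?_))
    have inner_b := orthonormal_iff_ite.1 b.orthonormal
    rw [b.repr_apply_apply, b.repr_apply_apply, ContinuousLinearMap.star_eq_adjoint,
      ContinuousLinearMap.adjoint_inner_right, hT, inner_b]
    split_ifs with hmn hij hij
    · rw [inner_b, if_pos (congrArg Prod.snd (β.injective hmn))]
    · exact absurd (congrArg Prod.fst (β.injective hmn)) hij
    · rw [inner_b, if_neg (fun h => hmn (by rw [h, hij]))]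
    · rw [inner_zero_right]
  refine ⟨T, fun i j => clm_ext_hilbertBasis b fun n => ?_, clm_ext_hilbertBasis b fun n => ?_⟩
  · rw [mul_apply_eq_comp, hT, star_T_apply]
    split_ifs <;> rfl
  · obtain ⟨⟨j, m⟩, rfl⟩ := β.surjective n
    rw [sum_apply, Finset.sum_eq_single j]
    · rw [mul_apply_eq_comp, star_T_apply, if_pos rfl, hT]
      rfl
    · intro i _ hi
      rw [mul_apply_eq_comp, star_T_apply, if_neg hi, map_zero]
    · exact fun h => absurd (Finset.mem_univ j) h

/-- The sequence space `ℓ²`. -/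
abbrev SeqSpace : Type u := lp (fun _ : ULift.{u} ℕ => ℂ) 2

theorem nontrivial_seqSpace : Nontrivial SeqSpace.{u} :=
  have b : HilbertBasis (ULift.{u} ℕ) ℂ SeqSpace.{u} := ⟨LinearIsometryEquiv.refl ℂ _⟩
  nontrivial_of_ne _ 0 (b.orthonormal.ne_zero ⟨0⟩)

theorem exists_isCuntzFamily_seqSpace (ι : Type*) [Fintype ι] [Nonempty ι] :
    ∃ T : ι → (SeqSpace.{u} →L[ℂ] SeqSpace.{u}), IsCuntzFamily T := by
  have : Encodable ι := Fintype.toEncodable ι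
  have : Denumerable (ι × ULift.{u} ℕ) := Denumerable.ofEncodableOfInfinite _
  exact exists_isCuntzFamily (HilbertBasis.ofRepr (LinearIsometryEquiv.refl ℂ _))
    ((Denumerable.eqv (ι × ULift.{u} ℕ)).trans Equiv.ulift.symm)

end CuntzFamily

namespace DirectedGraph

variable {V E : Type u} [Fintype V] [Fintype E] (Γ : DirectedGraph V E)

open Classical in
theorem isCKFamily_of_isCuntzFamily {B : Type u} [CStarAlgebra B] {U : V → B}
    {R : ∀ v, {e // Γ.s e = v} → B} (hU : IsCuntzFamily U)
    (hR : ∀ v, (∃ e, Γ.s e = v) → IsCuntzFamily (R v)) :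
    Γ.IsCKFamily (fun v => U v * star (U v))
      (fun e => U (Γ.s e) * R (Γ.s e) ⟨e, rfl⟩ * star (U (Γ.r e))) := by
  have cancel_U (v : V) (x : B) : star (U v) * (U v * x) = x := by
    rw [← mul_assoc, hU.star_mul_self, one_mul]
  have cancel_R (e : E) (x : B) : star (R (Γ.s e) ⟨e, rfl⟩) * (R (Γ.s e) ⟨e, rfl⟩ * x) = x := by
    rw [← mul_assoc, (hR _ ⟨e, rfl⟩).star_mul_self, one_mul]
  constructor
  · intro v
    rw [star_mul, star_star]
  · intro v w
    rw [mul_assoc, ← mul_assoc (star (U v)), hU.star_mul]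
    split_ifs with hvw
    · rw [one_mul, hvw]
    · rw [zero_mul, mul_zero]
  · exact hU.sum_mul_star
  · intro e
    simp only [star_mul, star_star, mul_assoc, cancel_U, cancel_R]
  · intro e
    simp only [star_mul, star_star, mul_assoc, cancel_U, cancel_R]
  · intro v hv
    have term : ∀ v (f : {e // Γ.s e = v}), U (Γ.s f) * R (Γ.s f) ⟨f, rfl⟩ * star (U (Γ.r f)) *
        star (U (Γ.s f) * R (Γ.s f) ⟨f, rfl⟩ * star (U (Γ.r f))) =
        U v * (R v f * star (R v f)) * star (U v) := by
      rintro _ ⟨f, rfl⟩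
      simp only [star_mul, star_star, mul_assoc, cancel_U]
    rw [Finset.sum_subtype (p := fun e => Γ.s e = v) _ (fun e => Finset.mem_filter_univ e),
      Finset.sum_congr rfl fun f _ => term v f]
    rw [← Finset.sum_mul, ← Finset.mul_sum, (hR v hv).sum_mul_star, mul_one]

theorem p_ne_zero (v : V) : Γ.p v ≠ 0 := by
  classical
  have : Nonempty V := ⟨v⟩
  have := nontrivial_seqSpace.{u}
  obtain ⟨U, hU⟩ := exists_isCuntzFamily_seqSpace.{u} V
  have exists_R (w : V) : ∃ R : {e // Γ.s e = w} → (SeqSpace.{u} →L[ℂ] SeqSpace.{u}),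
      (∃ e, Γ.s e = w) → IsCuntzFamily R := by
    rcases isEmpty_or_nonempty {e // Γ.s e = w} with h | h
    · exact ⟨fun _ => 0, fun ⟨e, he⟩ => (h.false ⟨e, he⟩).elim⟩
    · obtain ⟨R, hR⟩ := exists_isCuntzFamily_seqSpace.{u} {e // Γ.s e = w}
      exact ⟨R, fun _ => hR⟩
  choose R hR using exists_R
  have isCKFamily := Γ.isCKFamily_of_isCuntzFamily hU hR
  intro p_eq_zero
  have image_eq_zero : U v * star (U v) = 0 := by
    have lift_p := Γ.ckRelations.lift_gen (Sum.elim _ _) isCKFamily (Sum.inl v)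
    exact lift_p.symm.trans ((congrArg _ p_eq_zero).trans (map_zero _))
  have one_eq_zero : (1 : SeqSpace.{u} →L[ℂ] SeqSpace.{u}) = 0 := calc
    1 = star (U v) * (U v * star (U v)) * U v := by
      rw [← mul_assoc, hU.star_mul_self, one_mul, hU.star_mul_self]
    _ = 0 := by rw [image_eq_zero, mul_zero, zero_mul]
  exact one_ne_zero one_eq_zero

theorem exists_functional_p_eq_one (v : V) : ∃ ω : Γ.CStar →L[ℂ] ℂ, ω (Γ.p v) = 1 :=
  SeparatingDual.exists_eq_one (Γ.p_ne_zero v)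

open Classical in
theorem exists_functional_S_eq_ite (e : E) :
    ∃ ω : Γ.CStar →L[ℂ] ℂ, ∀ f, ω (Γ.S f) = if e = f then 1 else 0 := by
  obtain ⟨ω, hω⟩ := Γ.exists_functional_p_eq_one (Γ.r e)
  refine ⟨ω.comp (ContinuousLinearMap.mul ℂ Γ.CStar (star (Γ.S e))), fun f => ?_⟩
  change ω (star (Γ.S e) * Γ.S f) = _
  rw [Γ.isCKFamily_canonical.star_S_mul_S_eq_ite]
  split_ifs
  · exact hω
  · exact map_zero ω

open Classical in
theorem exists_isTau : ∃ τ, Γ.IsTau τ := by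
  have isCK := Γ.isCKFamily_canonical
  choose ω hω using Γ.exists_functional_p_eq_one
  let compression (a : Γ.CStar) (v : V) : Γ.CStar →ₗ[ℂ] ℂ :=
    (ω v : Γ.CStar →ₗ[ℂ] ℂ) ∘ₗ LinearMap.mulLeft ℂ (star a) ∘ₗ LinearMap.mulRight ℂ a
  have compression_apply (a : Γ.CStar) (v : V) (x : Γ.CStar) :
      compression a v x = ω v (star a * (x * a)) := rfl
  refine ⟨(∑ u ∈ Finset.univ.filter (fun u => ∀ e, Γ.s e ≠ u), compression (Γ.p u) u +
    ∑ e, compression (Γ.S e) (Γ.r e)) ∘ₗ Γ.V2plus.subtype, ?_, ?_⟩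
  · rintro x u hu hx
    rw [LinearMap.comp_apply, Submodule.subtype_apply, hx]
    simp only [LinearMap.add_apply, LinearMap.sum_apply, compression_apply]
    rw [Finset.sum_eq_single_of_mem u (Finset.mem_filter.2 ⟨Finset.mem_univ u, hu⟩),
      Finset.sum_eq_zero, add_zero, isCK.star_p, isCK.p_mul_self, isCK.p_mul_self, hω]
    · intro e _
      rw [isCK.p_mul_S_of_ne (hu e), mul_zero, map_zero]
    · intro v _ hv
      rw [isCK.p_mul_p, if_neg hv.symm, mul_zero, map_zero]
  · rintro x e f - hx
    rw [LinearMap.comp_apply, Submodule.subtype_apply, hx]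
    simp only [LinearMap.add_apply, LinearMap.sum_apply, compression_apply]
    rw [Finset.sum_eq_zero, zero_add, Finset.sum_eq_single f, mul_assoc, ← mul_assoc,
      isCK.star_S_mul_S, isCK.star_S_mul_S_eq_ite]
    · rw [@eq_comm _ f e]
      split_ifs
      · rw [isCK.p_mul_self, hω]
      · rw [zero_mul, map_zero]
    · intro g _ hg
      rw [mul_assoc, isCK.star_S_mul_S_of_ne hg.symm, mul_zero, mul_zero, map_zero]
    · exact fun h => absurd (Finset.mem_univ f) h
    · intro u hu
      rw [isCK.star_p, ← mul_assoc, ← mul_assoc,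
        isCK.p_mul_S_of_ne ((Finset.mem_filter.1 hu).2 e), zero_mul, zero_mul, map_zero]

end DirectedGraph

/-! ### Linear actions -/

theorem MinTensor.isSlice_sum_tmul {A B : Type u} [CStarAlgebra A] [CStarAlgebra B] {ι : Type*}
    (θ : A →L[ℂ] ℂ) (s : Finset ι) (a : ι → A) (b : ι → B) :
    MinTensor.IsSlice θ (∑ i ∈ s, MinTensor.tmul (a i) (b i)) (∑ i ∈ s, θ (a i) • b i) := by
  refine subset_closure ⟨∑ i ∈ s, a i ⊗ₜ b i, Prod.ext ?_ ?_⟩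
  · change MinTensor.ofAlg _ = _
    rw [map_sum]
    rfl
  · simp only [map_sum]
    rfl

theorem CStarRelations.dense_of_doublingEmb_mem {X : Type u} {R : CStarRelations X}
    {T : StarSubalgebra ℂ (R.Univ × R.Univ)} (one : ∀ k, doublingEmb R.Univ k 1 ∈ T)
    (gen : ∀ k x, doublingEmb R.Univ k (R.gen x) ∈ T) : Dense (T : Set (R.Univ × R.Univ)) := by
  have emb_mem (k : Bool) (a : R.Univ) : doublingEmb R.Univ k a ∈ T.topologicalClosure := by
    induction a using R.univ_induction with
    | isClosed => exact T.isClosed_topologicalClosure.preimage (map_continuous (doublingEmb _ k))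
    | one => exact T.le_topologicalClosure (one k)
    | gen x => exact T.le_topologicalClosure (gen k x)
    | star_gen x =>
      rw [map_star]
      exact star_mem (T.le_topologicalClosure (gen k x))
    | smul c a ha =>
      rw [map_smul]
      exact SMulMemClass.smul_mem c ha
    | mul a b ha hb =>
      rw [map_mul]
      exact mul_mem ha hb
    | add a b ha hb =>
      rw [map_add]
      exact add_mem ha hb
  intro q
  obtain ⟨c, rfl⟩ := exists_eq_sum_doublingEmb q
  have sum_mem_closure : ∑ k, doublingEmb R.Univ k (c k) ∈ T.topologicalClosure :=
    sum_mem fun k _ => emb_mem k (c k)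
  exact sum_mem_closure

namespace DirectedGraph

variable {V E : Type u} [Fintype V] [Fintype E] {Γ : DirectedGraph V E}

theorem S_mul_star_S_mem_V2plus (Γ : DirectedGraph V E) (e f : E) :
    Γ.S e * star (Γ.S f) ∈ Γ.V2plus := by
  by_cases hef : Γ.r e = Γ.r f
  · exact Submodule.subset_span (Or.inr ⟨e, f, hef, rfl⟩)
  · rw [Γ.isCKFamily_canonical.S_mul_star_S_of_ne hef]
    exact zero_mem _

open Classical in
theorem IsTau.apply_S_mul_star_S {τ : Γ.V2plus →ₗ[ℂ] ℂ} (hτ : Γ.IsTau τ) (e f : E) :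
    τ ⟨Γ.S e * star (Γ.S f), Γ.S_mul_star_S_mem_V2plus e f⟩ = if e = f then 1 else 0 := by
  by_cases hef : Γ.r e = Γ.r f
  · exact hτ.2 _ e f hef rfl
  · rw [if_neg (fun h => hef (congrArg Γ.r h)), ← map_zero τ]
    exact congrArg τ (Subtype.ext (Γ.isCKFamily_canonical.S_mul_star_S_of_ne hef))

variable {Q : Type u} [CStarAlgebra Q] {α : Γ.CStar →⋆ₐ[ℂ] MinTensor Γ.CStar Q} {q : E → E → Q}

theorem coeff_mem_adjoin_slices (hα : ∀ e, α (Γ.S e) = ∑ f, MinTensor.tmul (Γ.S f) (q f e))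
    (f e : E) : q f e ∈ StarAlgebra.adjoin ℂ
      {b : Q | ∃ (θ : Γ.CStar →L[ℂ] ℂ) (x : Γ.CStar), MinTensor.IsSlice θ (α x) b} := by
  classical
  obtain ⟨ω, hω⟩ := Γ.exists_functional_S_eq_ite f
  refine StarAlgebra.subset_adjoin ℂ _ ⟨ω, Γ.S e, ?_⟩
  have slice := MinTensor.isSlice_sum_tmul ω Finset.univ Γ.S (q · e)
  simp only [hω, ite_smul, one_smul, zero_smul, Finset.sum_ite_eq, Finset.mem_univ, if_true]
    at slice
  rwa [hα]

theorem apply_S_mul_star_S (hα : ∀ e, α (Γ.S e) = ∑ f, MinTensor.tmul (Γ.S f) (q f e)) (e f : E) :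
    α (Γ.S e * star (Γ.S f)) =
      ∑ g, ∑ h, MinTensor.tmul (Γ.S g * star (Γ.S h)) (q g e * star (q h f)) := by
  simp only [map_mul, map_star, hα, star_sum, Finset.sum_mul_sum, MinTensor.star_tmul,
    MinTensor.tmul_mul_tmul]

open Classical in
theorem preservesTau_of_linear
    (hαp : ∀ u, (∀ e, Γ.s e ≠ u) → α (Γ.p u) = MinTensor.tmul (Γ.p u) 1)
    (hα : ∀ e, α (Γ.S e) = ∑ f, MinTensor.tmul (Γ.S f) (q f e))
    (hq : ∀ e f, ∑ g, q g e * star (q g f) = if e = f then 1 else 0) : Γ.PreservesTau α := by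
  obtain ⟨τ, hτ⟩ := Γ.exists_isTau
  refine ⟨τ, hτ, fun ⟨x, hx⟩ => ?_⟩
  induction hx using Submodule.span_induction with
  | mem x hx =>
    rcases hx with ⟨u, hu, rfl⟩ | ⟨e, f, hef, rfl⟩
    · refine ⟨⟨Γ.p u, Submodule.subset_span (Or.inl ⟨u, hu, rfl⟩)⟩ ⊗ₜ 1, ?_, rfl⟩
      exact (hαp u hu).symm
    · refine ⟨∑ g, ∑ h, ⟨_, Γ.S_mul_star_S_mem_V2plus g h⟩ ⊗ₜ (q g e * star (q h f)), ?_, ?_⟩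
      · rw [apply_S_mul_star_S hα]
        simp only [map_sum]
        rfl
      · simp only [map_sum, TensorProduct.map_tmul, TensorProduct.lid_tmul, hτ.apply_S_mul_star_S,
          ite_smul, one_smul, zero_smul, Finset.sum_ite_eq, Finset.mem_univ, if_true,
          LinearMap.id_apply, hq]
  | zero =>
    refine ⟨0, by simp only [map_zero], ?_⟩
    rw [map_zero, map_zero]
    exact (congrArg (· • (1 : Q)) (map_zero τ)).trans (zero_smul ℂ 1) |>.symm
  | add x x' hx hx' ih ih' =>
    obtain ⟨y, hy, hτy⟩ := ih
    obtain ⟨y', hy', hτy'⟩ := ih'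
    refine ⟨y + y', ?_, ?_⟩
    · simp only [map_add, hy, hy']
    · rw [map_add, map_add, hτy, hτy', ← add_smul, ← map_add]
      rfl
  | smul c x hx ih =>
    obtain ⟨y, hy, hτy⟩ := ih
    refine ⟨c • y, ?_, ?_⟩
    · simp only [map_smul, hy]
    · rw [map_smul, map_smul, hτy, ← smul_assoc, ← map_smul]
      rfl

end DirectedGraph

/-! ### Free products of circles -/

namespace CStarRelations

open MinTensor

variable {X : Type u} {R : CStarRelations X} {Q : Type u} [CStarAlgebra Q]
  {Δ : Q →⋆ₐ[ℂ] MinTensor Q Q} {α : R.Univ →⋆ₐ[ℂ] MinTensor R.Univ Q}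

theorem assocRel_of_groupLike
    (gen : ∀ x, ∃ u, Δ u = tmul u u ∧ α (R.gen x) = tmul (R.gen x) u) (a : R.Univ) : AssocRel
      (map (α : R.Univ →⋆ₙₐ[ℂ] MinTensor R.Univ Q) (NonUnitalStarAlgHom.id ℂ Q) (α a))
      (map (NonUnitalStarAlgHom.id ℂ R.Univ) (Δ : Q →⋆ₙₐ[ℂ] MinTensor Q Q) (α a)) := by
  have of_groupLike {x : R.Univ} {u : Q} (hu : Δ u = tmul u u) (hx : α x = tmul x u) : AssocRel
      (map (α : R.Univ →⋆ₙₐ[ℂ] MinTensor R.Univ Q) (NonUnitalStarAlgHom.id ℂ Q) (α x))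
      (map (NonUnitalStarAlgHom.id ℂ R.Univ) (Δ : Q →⋆ₙₐ[ℂ] MinTensor Q Q) (α x)) := by
    rw [hx, map_tmul, map_tmul]
    change AssocRel (tmul (α x) u) (tmul x (Δ u))
    rw [hx, hu]
    exact AssocRel.tmul x u u
  refine AssocRel.of_generators R
    ((map (α : R.Univ →⋆ₙₐ[ℂ] MinTensor R.Univ Q) (NonUnitalStarAlgHom.id ℂ Q)).comp
      (α : R.Univ →⋆ₙₐ[ℂ] MinTensor R.Univ Q))
    ((map (NonUnitalStarAlgHom.id ℂ R.Univ) (Δ : Q →⋆ₙₐ[ℂ] MinTensor Q Q)).comp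
      (α : R.Univ →⋆ₙₐ[ℂ] MinTensor R.Univ Q))
    (of_groupLike ((map_one Δ).trans one_def) ((map_one α).trans one_def)) (fun x => ?_) a
  obtain ⟨u, hu, hx⟩ := gen x
  exact of_groupLike hu hx

theorem dense_productSpan_of_unitary
    (gen : ∀ x, ∃ u ∈ unitary Q, α (R.gen x) = tmul (R.gen x) u) :
    Dense (productSpan α includeRight : Set (MinTensor R.Univ Q)) := by
  refine dense_of_tmul_mem fun a b => ?_
  rw [← includeLeft_mul_includeRight]
  refine mul_mem_closure_productSpan_of_mem (mem_closure_productSpan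
    commute_includeLeft_includeRight (fun x => ?_) a) b
  obtain ⟨u, hu, hx⟩ := gen x
  exact ⟨u, hu, hx.trans (includeLeft_mul_includeRight _ _).symm⟩

end CStarRelations

namespace FreeCircles

open MinTensor

variable {E : Type u}

theorem isCompactQuantumGroup : IsCompactQuantumGroup (comul E) where
  coassoc := CStarRelations.assocRel_of_groupLike fun e => ⟨z e, comul_z e, comul_z e⟩
  dense_right := CStarRelations.dense_productSpan_of_unitary fun e => ⟨z e, z_unitary e, comul_z e⟩
  dense_left := by
    refine dense_of_tmul_mem (T := productSpan (comul E) includeLeft) fun a b => ?_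
    rw [← includeRight_mul_includeLeft]
    refine mul_mem_closure_productSpan_of_mem (CStarRelations.mem_closure_productSpan
      (fun b a => (commute_includeLeft_includeRight a b).symm) (fun e => ?_) b) a
    exact ⟨z e, z_unitary e, (comul_z e).trans (includeRight_mul_includeLeft _ _).symm⟩

/-- The universal property of the free product of circles: the homomorphism `z e ↦ u e`. -/
def lift {B : Type u} [CStarAlgebra B] (u : E → unitary B) : FreeCircles E →⋆ₐ[ℂ] B :=
  (unitaryRelations E).lift (fun e => (u e : B)) fun e => (u e).2

theorem lift_z {B : Type u} [CStarAlgebra B] (u : E → unitary B) (e : E) : lift u (z e) = u e :=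
  (unitaryRelations E).lift_gen _ _ e

variable {E' : Type u}

/-- The homomorphism `z e ↦ z (σ e)` induced by a map between the index sets. -/
def map (σ : E → E') : FreeCircles E →⋆ₐ[ℂ] FreeCircles E' :=
  lift fun e => ⟨z (σ e), z_unitary (σ e)⟩

theorem map_z (σ : E → E') (e : E) : map σ (z e) = z (σ e) :=
  lift_z _ e

theorem map_map_of_leftInverse {σ : E → E'} {ρ : E' → E} (h : Function.LeftInverse ρ σ)
    (a : FreeCircles E) : map ρ (map σ a) = a := by
  refine (unitaryRelations E).univ_hom_ext
    (f := ((map ρ).comp (map σ) : FreeCircles E →⋆ₙₐ[ℂ] FreeCircles E))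
    (g := NonUnitalStarAlgHom.id ℂ _) (map_one ((map ρ).comp (map σ))) (fun e => ?_) a
  change map ρ (map σ (z e)) = z e
  rw [map_z, map_z, h]

theorem isCQGMorphism_map (σ : E → E') : IsCQGMorphism (comul E) (comul E') (map σ) := by
  refine (unitaryRelations E).univ_hom_ext
    (f := (MinTensor.map (map σ : FreeCircles E →⋆ₙₐ[ℂ] FreeCircles E')
        (map σ : FreeCircles E →⋆ₙₐ[ℂ] FreeCircles E')).comp
      (comul E : FreeCircles E →⋆ₙₐ[ℂ] MinTensor (FreeCircles E) (FreeCircles E)))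
    (g := ((comul E').comp (map σ) :
      FreeCircles E →⋆ₙₐ[ℂ] MinTensor (FreeCircles E') (FreeCircles E'))) ?_ fun e => ?_
  · change MinTensor.map _ _ (comul E 1) = comul E' (map σ 1)
    rw [map_one (comul E), map_one (map σ), map_one (comul E'), one_def, one_def, map_tmul]
    exact congrArg₂ tmul (map_one (map σ)) (map_one (map σ))
  · change MinTensor.map _ _ (comul E (z e)) = comul E' (map σ (z e))
    rw [comul_z, map_tmul, map_z, comul_z]
    exact congrArg₂ tmul (map_z σ e) (map_z σ e)

/-- The automorphism `z e ↦ z (σ e)` induced by a permutation of the index set. -/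
def permEquiv (σ : Equiv.Perm E) : FreeCircles E ≃⋆ₐ[ℂ] FreeCircles E :=
  StarAlgEquiv.ofAlgEquiv
    (AlgEquiv.ofBijective (map σ : FreeCircles E →ₐ[ℂ] FreeCircles E)
      ⟨Function.LeftInverse.injective (map_map_of_leftInverse σ.left_inv),
        Function.RightInverse.surjective (map_map_of_leftInverse σ.right_inv)⟩) (map_star (map σ))

end FreeCircles

/-! ### The doubled action -/

namespace FreeCircles

variable {E : Type u}

open Classical in
/-- The matrix coefficients of the doubled action `S e ↦ S e ⊗ (z e, 0) + S (σ e) ⊗ (0, z (σ e))` of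
the doubling of the free product of circles. -/
def doubledCoeff (σ : Equiv.Perm E) (f e : E) : FreeCircles E × FreeCircles E :=
  (if f = e then z f else 0, if f = σ e then z f else 0)

open Classical in
theorem sum_doubledCoeff_mul_star [Fintype E] (σ : Equiv.Perm E) (e f : E) :
    ∑ g, doubledCoeff σ g e * star (doubledCoeff σ g f) = if e = f then 1 else 0 := by
  have sum_single_mul_star (e f : E) :
      ∑ g, (if g = e then z g else 0) * star (if g = f then z g else 0) =
        if e = f then (1 : FreeCircles E) else 0 := by
    simp only [ite_mul, zero_mul, Finset.sum_ite_eq', Finset.mem_univ, if_true]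
    split_ifs
    · exact (z_unitary e).2
    · rw [star_zero, mul_zero]
  refine Prod.ext ?_ ?_
  · rw [Prod.fst_sum]
    exact (sum_single_mul_star e f).trans (by split_ifs <;> rfl)
  · rw [Prod.snd_sum]
    refine (sum_single_mul_star (σ e) (σ f)).trans ?_
    rw [σ.injective.eq_iff]
    split_ifs <;> rfl

theorem doublingEmb_z_mem_of_doubledCoeff_mem {σ : Equiv.Perm E} {e₀ : E} (he₀ : σ e₀ ≠ e₀)
    {T : StarSubalgebra ℂ (FreeCircles E × FreeCircles E)} (hT : ∀ f e, doubledCoeff σ f e ∈ T) :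
    (∀ k, doublingEmb (FreeCircles E) k 1 ∈ T) ∧
      ∀ k e, doublingEmb (FreeCircles E) k (z e) ∈ T := by
  have zeta_one : ((1, 0) : FreeCircles E × FreeCircles E) ∈ T := by
    have coeff_e₀ : doubledCoeff σ e₀ e₀ = (z e₀, 0) :=
      Prod.ext (if_pos rfl) (if_neg he₀.symm)
    have mem := mul_mem (star_mem (hT e₀ e₀)) (hT e₀ e₀)
    rw [coeff_e₀] at mem
    convert mem using 1
    exact Prod.ext (z_unitary e₀).1.symm (mul_zero _).symm
  have eta_one : ((0, 1) : FreeCircles E × FreeCircles E) ∈ T := by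
    convert sub_mem (one_mem T) zeta_one using 1
    exact Prod.ext (sub_self _).symm (sub_zero _).symm
  refine ⟨Bool.rec zeta_one eta_one, Bool.rec (fun e => ?_) fun e => ?_⟩
  · convert mul_mem zeta_one (hT e e) using 1
    exact Prod.ext ((one_mul _).trans (if_pos rfl)).symm (zero_mul _).symm
  · convert mul_mem eta_one (hT e (σ.symm e)) using 1
    exact Prod.ext (zero_mul _).symm
      ((one_mul _).trans (if_pos (σ.apply_symm_apply e).symm)).symm

end FreeCircles

namespace DirectedGraph

open MinTensor FreeCircles

variable {V E : Type u} (Γ : DirectedGraph V E)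

/-- A permutation of the edges of a graph that fixes the source and the range of every edge, so that
it induces a symmetry of the graph C*-algebra fixing the vertex projections. -/
structure IsEdgeSymmetry (σ : Equiv.Perm E) : Prop where
  s_apply : ∀ e, Γ.s (σ e) = Γ.s e
  r_apply : ∀ e, Γ.r (σ e) = Γ.r e

theorem isEdgeSymmetry_swap [DecidableEq E] {e₁ e₂ : E} (hs : Γ.s e₁ = Γ.s e₂)
    (hr : Γ.r e₁ = Γ.r e₂) : Γ.IsEdgeSymmetry (Equiv.swap e₁ e₂) where
  s_apply e := by rw [Equiv.apply_swap_eq_self hs]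
  r_apply e := by rw [Equiv.apply_swap_eq_self hr]

variable [Fintype V] [Fintype E]

/-- The canonical action `S e ↦ S e ⊗ z e` of the free product of circles on the graph
C*-algebra. -/
def circleAction : Γ.CStar →⋆ₐ[ℂ] MinTensor Γ.CStar (FreeCircles E) :=
  Γ.ckRelations.lift
    (Sum.elim (fun v => tmul (Γ.p v) 1) fun e => tmul (Γ.S e) (z e))
    (Γ.isCKFamily_canonical.tmul_unitary fun e => ⟨z e, z_unitary e⟩)

theorem circleAction_p (v : V) : Γ.circleAction (Γ.p v) = tmul (Γ.p v) 1 :=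
  Γ.ckRelations.lift_gen _ _ (Sum.inl v)

theorem circleAction_S (e : E) : Γ.circleAction (Γ.S e) = tmul (Γ.S e) (z e) :=
  Γ.ckRelations.lift_gen _ _ (Sum.inr e)

theorem circleAction_coaction (x : Γ.CStar) : AssocRel
    (MinTensor.map (Γ.circleAction : Γ.CStar →⋆ₙₐ[ℂ] MinTensor Γ.CStar (FreeCircles E))
      (NonUnitalStarAlgHom.id ℂ (FreeCircles E)) (Γ.circleAction x))
    (MinTensor.map (NonUnitalStarAlgHom.id ℂ Γ.CStar)
      (comul E : FreeCircles E →⋆ₙₐ[ℂ] MinTensor (FreeCircles E) (FreeCircles E))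
      (Γ.circleAction x)) := by
  refine CStarRelations.assocRel_of_groupLike (R := Γ.ckRelations) (Sum.rec (fun v => ?_)
    fun e => ?_) x
  · exact ⟨1, (map_one (comul E)).trans one_def, Γ.circleAction_p v⟩
  · exact ⟨z e, comul_z e, Γ.circleAction_S e⟩

theorem dense_productSpan_circleAction :
    Dense (productSpan Γ.circleAction includeRight : Set (MinTensor Γ.CStar (FreeCircles E))) := by
  refine CStarRelations.dense_productSpan_of_unitary (R := Γ.ckRelations) (Sum.rec (fun v => ?_)
    fun e => ?_)
  · exact ⟨1, one_mem _, Γ.circleAction_p v⟩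
  · exact ⟨z e, z_unitary e, Γ.circleAction_S e⟩

namespace IsEdgeSymmetry

variable {Γ} {σ : Equiv.Perm E}

/-- The endomorphism `S e ↦ S (σ e)` of the graph C*-algebra that fixes the vertex projections. -/
def permHom (h : Γ.IsEdgeSymmetry σ) : Γ.CStar →⋆ₐ[ℂ] Γ.CStar :=
  Γ.ckRelations.lift (Sum.elim Γ.p (Γ.S ∘ σ))
    (Γ.isCKFamily_canonical.comp_perm h.s_apply h.r_apply)

variable (h : Γ.IsEdgeSymmetry σ)

theorem permHom_p (v : V) : h.permHom (Γ.p v) = Γ.p v :=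
  Γ.ckRelations.lift_gen _ _ (Sum.inl v)

theorem permHom_S (e : E) : h.permHom (Γ.S e) = Γ.S (σ e) :=
  Γ.ckRelations.lift_gen _ _ (Sum.inr e)

theorem permHom_permHom (hσ : Function.Involutive σ) (x : Γ.CStar) :
    h.permHom (h.permHom x) = x := by
  refine Γ.ckRelations.univ_hom_ext
    (f := (h.permHom.comp h.permHom : Γ.CStar →⋆ₙₐ[ℂ] Γ.CStar))
    (g := NonUnitalStarAlgHom.id ℂ _) (map_one (h.permHom.comp h.permHom))
    (Sum.rec (fun v => ?_) fun e => ?_) x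
  · change h.permHom (h.permHom (Γ.p v)) = Γ.p v
    rw [h.permHom_p, h.permHom_p]
  · change h.permHom (h.permHom (Γ.S e)) = Γ.S e
    rw [h.permHom_S, h.permHom_S, hσ]

theorem map_permHom_map_circleAction (x : Γ.CStar) :
    MinTensor.map (h.permHom : Γ.CStar →⋆ₙₐ[ℂ] Γ.CStar)
      (FreeCircles.map σ : FreeCircles E →⋆ₙₐ[ℂ] FreeCircles E) (Γ.circleAction x) =
    Γ.circleAction (h.permHom x) := by
  refine Γ.ckRelations.univ_hom_ext
    (f := (MinTensor.map (h.permHom : Γ.CStar →⋆ₙₐ[ℂ] Γ.CStar)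
      (FreeCircles.map σ : FreeCircles E →⋆ₙₐ[ℂ] FreeCircles E)).comp
      (Γ.circleAction : Γ.CStar →⋆ₙₐ[ℂ] MinTensor Γ.CStar (FreeCircles E)))
    (g := (Γ.circleAction.comp h.permHom : Γ.CStar →⋆ₙₐ[ℂ] MinTensor Γ.CStar (FreeCircles E)))
    ?_ (Sum.rec (fun v => ?_) fun e => ?_) x
  · change MinTensor.map _ _ (Γ.circleAction 1) = Γ.circleAction (h.permHom 1)
    rw [map_one h.permHom, map_one Γ.circleAction, one_def, map_tmul]
    exact congrArg₂ tmul (map_one h.permHom) (map_one (FreeCircles.map σ))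
  · change MinTensor.map _ _ (Γ.circleAction (Γ.p v)) = Γ.circleAction (h.permHom (Γ.p v))
    rw [h.permHom_p, circleAction_p, map_tmul]
    exact congrArg₂ tmul (h.permHom_p v) (map_one (FreeCircles.map σ))
  · change MinTensor.map _ _ (Γ.circleAction (Γ.S e)) = Γ.circleAction (h.permHom (Γ.S e))
    rw [h.permHom_S, circleAction_S, circleAction_S, map_tmul]
    exact congrArg₂ tmul (h.permHom_S e) (map_z σ e)

theorem doubledAction_circleAction_p (v : V) :
    doubledAction Γ.circleAction h.permHom (Γ.p v) = tmul (Γ.p v) 1 := by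
  have boolPow_p (i : Bool) : boolPow h.permHom i (Γ.p v) = Γ.p v := by
    cases i
    · rfl
    · exact h.permHom_p v
  simp only [doubledAction_apply, boolPow_p, circleAction_p, map_tmul, ← tmul_sum, sum_doublingEmb]
  rfl

theorem doubledAction_circleAction_S (e : E) :
    doubledAction Γ.circleAction h.permHom (Γ.S e) =
      tmul (Γ.S e) (z e, 0) + tmul (Γ.S (σ e)) (0, z (σ e)) := by
  rw [doubledAction_apply, Fintype.sum_bool, add_comm]
  change MinTensor.map _ _ (Γ.circleAction (Γ.S e)) +
    MinTensor.map _ _ (Γ.circleAction (h.permHom (Γ.S e))) = _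
  rw [h.permHom_S, circleAction_S, circleAction_S, map_tmul, map_tmul]
  rfl

theorem doubledAction_circleAction_S_eq_sum (e : E) :
    doubledAction Γ.circleAction h.permHom (Γ.S e) =
      ∑ f, tmul (Γ.S f) (doubledCoeff σ f e) := by
  classical
  have coeff_eq (f : E) : doubledCoeff σ f e =
      (if f = e then (z f, 0) else 0) + if f = σ e then (0, z f) else 0 := by
    unfold doubledCoeff
    split_ifs <;> simp only [Prod.mk_add_mk, add_zero, zero_add, Prod.mk_zero_zero]
  simp only [coeff_eq, tmul_add, apply_ite (tmul _), tmul_zero, Finset.sum_add_distrib,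
    Finset.sum_ite_eq', Finset.mem_univ, if_true, h.doubledAction_circleAction_S]

theorem isObject (hσ : Function.Involutive σ) {e₀ : E} (he₀ : σ e₀ ≠ e₀) :
    Γ.IsObject (doublingComul (comul E) (FreeCircles.map σ))
      (doubledAction Γ.circleAction h.permHom) where
  isCQG := isCompactQuantumGroup.doubling (map_map_of_leftInverse hσ) (isCQGMorphism_map σ)
  faithfulAction :=
    { coaction := doubledAction_coaction Γ.circleAction_coaction (h.permHom_permHom hσ)
        h.map_permHom_map_circleAction
      dense := dense_productSpan_doubledAction (h.permHom_permHom hσ)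
        Γ.dense_productSpan_circleAction
      faithful := by
        obtain ⟨one_mem, z_mem⟩ := doublingEmb_z_mem_of_doubledCoeff_mem he₀
          (coeff_mem_adjoin_slices h.doubledAction_circleAction_S_eq_sum)
        exact CStarRelations.dense_of_doublingEmb_mem one_mem z_mem }
  isLinear := ⟨doubledCoeff σ, h.doubledAction_circleAction_S_eq_sum⟩
  preservesTau := preservesTau_of_linear (fun v _ => h.doubledAction_circleAction_p v)
    h.doubledAction_circleAction_S_eq_sum (sum_doubledCoeff_mul_star σ)

end IsEdgeSymmetry

end DirectedGraph

/-! ### Convolution of characters -/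

theorem MinTensor.tmul_ne_zero {A B H K : Type u} [CStarAlgebra A] [CStarAlgebra B]
    [NormedAddCommGroup H] [InnerProductSpace ℂ H] [CompleteSpace H]
    [NormedAddCommGroup K] [InnerProductSpace ℂ K] [CompleteSpace K]
    {π : A →⋆ₙₐ[ℂ] (H →L[ℂ] H)} {ρ : B →⋆ₙₐ[ℂ] (K →L[ℂ] K)} {a : A} {b : B} (ha : π a ≠ 0)
    (hb : ρ b ≠ 0) : (tmul a b : MinTensor A B) ≠ 0 := by
  obtain ⟨ξ, hξ⟩ := DFunLike.ne_iff.1 ha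
  obtain ⟨η, hη⟩ := DFunLike.ne_iff.1 hb
  intro tmul_eq_zero
  have minNorm_eq_zero : (minNorm A B).toFun (a ⊗ₜ b) = 0 := by
    rw [← CStarSeminorm.norm_coe]
    exact norm_eq_zero.2 tmul_eq_zero
  have rep_norm_le := (CStarSeminorm.le_sup (repSeminorms A B) (repSeminorms_bdd A B)
    ⟨H, K, _, _, _, _, _, _, π, ρ, rfl⟩ (a ⊗ₜ b)).trans_eq minNorm_eq_zero
  have norm_image_le := (ContinuousLinearMap.le_opNorm (TensorProduct.mapL (π a) (ρ b))
    (ξ ⊗ₜ[ℂ] η)).trans (mul_le_mul_of_nonneg_right rep_norm_le (norm_nonneg _))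
  rw [TensorProduct.mapL_tmul, zero_mul, TensorProduct.norm_tmul] at norm_image_le
  exact norm_image_le.not_gt (mul_pos (norm_pos_iff.2 hξ) (norm_pos_iff.2 hη))

/-- The C*-algebra of complex numbers, as an algebra of functions on a point in order to have a copy
of it in every universe. -/
abbrev Scalars : Type u := PUnit.{u + 1} → ℂ

namespace Scalars

open MinTensor

theorem tmul_comm (a b : Scalars.{u}) : tmul a b = tmul b a := by
  have eq_smul_one (a : Scalars.{u}) : a = a PUnit.unit • 1 :=
    funext fun _ => (mul_one _).symm
  rw [eq_smul_one a, eq_smul_one b]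
  simp only [smul_tmul, tmul_smul]
  rw [smul_comm]

theorem tmul_one_one_ne_zero : (tmul 1 1 : MinTensor Scalars.{u} Scalars.{u}) ≠ 0 := by
  let H := EuclideanSpace ℂ PUnit.{u + 1}
  let π : Scalars.{u} →⋆ₐ[ℂ] (H →L[ℂ] H) :=
    (StarAlgHom.ofId ℂ (H →L[ℂ] H)).comp (Pi.evalStarAlgHom ℂ (fun _ => ℂ) PUnit.unit)
  have π_one_ne_zero : (π : Scalars.{u} →⋆ₙₐ[ℂ] (H →L[ℂ] H)) 1 ≠ 0 :=
    (map_one π).trans_ne one_ne_zero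
  exact tmul_ne_zero π_one_ne_zero π_one_ne_zero

end Scalars

/-- The characters of the quantum semigroup `(Q, Δ)` commute under the convolution
`(f, g) ↦ (f ⊗ g) Δ`. -/
def CharactersCommute {Q : Type u} [CStarAlgebra Q] (Δ : Q →⋆ₐ[ℂ] MinTensor Q Q) : Prop :=
  ∀ (f g : Q →⋆ₐ[ℂ] Scalars.{u}) (a : Q),
    MinTensor.map (f : Q →⋆ₙₐ[ℂ] Scalars.{u}) (g : Q →⋆ₙₐ[ℂ] Scalars.{u}) (Δ a) =
      MinTensor.map (g : Q →⋆ₙₐ[ℂ] Scalars.{u}) (f : Q →⋆ₙₐ[ℂ] Scalars.{u}) (Δ a)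

section CharactersCommute

open MinTensor

variable {Q Q' : Type u} [CStarAlgebra Q] [CStarAlgebra Q'] {Δ : Q →⋆ₐ[ℂ] MinTensor Q Q}
  {Δ' : Q' →⋆ₐ[ℂ] MinTensor Q' Q'}

theorem CharactersCommute.of_surjective (h : CharactersCommute Δ) {Φ : Q →⋆ₐ[ℂ] Q'}
    (hΦ : IsCQGMorphism Δ Δ' Φ) (surj : Function.Surjective Φ) : CharactersCommute Δ' := by
  intro f g b
  obtain ⟨a, rfl⟩ := surj b
  rw [← hΦ a, map_map, map_map]
  exact h (f.comp Φ) (g.comp Φ) a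

theorem IsCQGMorphism.symm {Ψ : Q ≃⋆ₐ[ℂ] Q'} (hΨ : IsCQGMorphism Δ Δ' (Ψ : Q →⋆ₐ[ℂ] Q')) :
    IsCQGMorphism Δ' Δ (Ψ.symm : Q' →⋆ₐ[ℂ] Q) := by
  have symm_comp : ((Ψ.symm : Q' →⋆ₐ[ℂ] Q) : Q' →⋆ₙₐ[ℂ] Q).comp
      ((Ψ : Q →⋆ₐ[ℂ] Q') : Q →⋆ₙₐ[ℂ] Q') = NonUnitalStarAlgHom.id ℂ Q :=
    NonUnitalStarAlgHom.ext Ψ.symm_apply_apply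
  intro b
  obtain ⟨a, rfl⟩ := EquivLike.surjective Ψ b
  rw [show Δ' (Ψ a) = _ from (hΨ a).symm, map_map, symm_comp, map_id]
  exact congrArg Δ (Ψ.symm_apply_apply a).symm

theorem CharactersCommute.of_areIsomorphicCQG (h : CharactersCommute Δ')
    (iso : AreIsomorphicCQG Δ Δ') : CharactersCommute Δ :=
  let ⟨Ψ, hΨ⟩ := iso
  h.of_surjective hΨ.symm (EquivLike.surjective Ψ.symm)

theorem CharactersCommute.of_doubling {φ : Q →⋆ₐ[ℂ] Q}
    (h : CharactersCommute (doublingComul Δ φ)) (χ ψ : Q →⋆ₐ[ℂ] Scalars.{u}) (a : Q) :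
    map (χ : Q →⋆ₙₐ[ℂ] Scalars.{u}) (ψ.comp φ : Q →⋆ₙₐ[ℂ] Scalars.{u}) (Δ a) =
      map (ψ : Q →⋆ₙₐ[ℂ] Scalars.{u}) (χ.comp φ : Q →⋆ₙₐ[ℂ] Scalars.{u}) (Δ a) := by
  have convolution (χ ψ : Q →⋆ₐ[ℂ] Scalars.{u}) :
      map (χ.comp (StarAlgHom.snd ℂ Q Q) : Q × Q →⋆ₙₐ[ℂ] Scalars.{u})
          (ψ.comp (StarAlgHom.snd ℂ Q Q) : Q × Q →⋆ₙₐ[ℂ] Scalars.{u})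
          (doublingComul Δ φ (zetaHom Q a)) =
        map (χ : Q →⋆ₙₐ[ℂ] Scalars.{u}) (ψ.comp φ : Q →⋆ₙₐ[ℂ] Scalars.{u}) (Δ a) := by
    rw [doublingComul_zeta, _root_.map_add, map_map, map_map,
      map_eq_zero_of_left (fun _ => _root_.map_zero χ), zero_add]
    rfl
  rw [← convolution, ← convolution, h]

end CharactersCommute

namespace FreeCircles

open MinTensor

variable {E : Type u}

theorem charactersCommute_comul : CharactersCommute (comul E) := by
  intro f g
  refine (unitaryRelations E).univ_hom_ext
    (f := (MinTensor.map (f : FreeCircles E →⋆ₙₐ[ℂ] Scalars.{u})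
        (g : FreeCircles E →⋆ₙₐ[ℂ] Scalars.{u})).comp
      (comul E : FreeCircles E →⋆ₙₐ[ℂ] MinTensor (FreeCircles E) (FreeCircles E)))
    (g := (MinTensor.map (g : FreeCircles E →⋆ₙₐ[ℂ] Scalars.{u})
        (f : FreeCircles E →⋆ₙₐ[ℂ] Scalars.{u})).comp
      (comul E : FreeCircles E →⋆ₙₐ[ℂ] MinTensor (FreeCircles E) (FreeCircles E)))
    ?_ fun e => ?_
  · change MinTensor.map _ _ (comul E 1) = MinTensor.map _ _ (comul E 1)
    rw [map_one (comul E), one_def, map_tmul, map_tmul, Scalars.tmul_comm]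
  · change MinTensor.map _ _ (comul E (z e)) = MinTensor.map _ _ (comul E (z e))
    rw [comul_z, map_tmul, map_tmul, Scalars.tmul_comm]

theorem not_charactersCommute_doublingComul {σ : E → E} {e₀ : E} (he₀ : σ e₀ ≠ e₀) :
    ¬ CharactersCommute (doublingComul (comul E) (map σ)) := by
  classical
  intro h
  let χ : FreeCircles E →⋆ₐ[ℂ] Scalars.{u} := lift fun e => if e = e₀ then -1 else 1
  let ψ : FreeCircles E →⋆ₐ[ℂ] Scalars.{u} := lift fun _ => 1
  have χ_e₀ : χ (z e₀) = -1 := by rw [lift_z, if_pos rfl]; rfl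
  have χ_σe₀ : χ (z (σ e₀)) = 1 := by rw [lift_z, if_neg he₀]; rfl
  have ψ_z (e : E) : ψ (z e) = 1 := lift_z _ e
  have key := h.of_doubling χ ψ (z e₀)
  rw [comul_z, map_tmul, map_tmul] at key
  change tmul (χ (z e₀)) (ψ (map σ (z e₀))) = tmul (ψ (z e₀)) (χ (map σ (z e₀))) at key
  rw [map_z, χ_e₀, χ_σe₀, ψ_z, ψ_z, ← neg_one_smul ℂ, smul_tmul, neg_one_smul] at key
  have two_smul_eq_zero : (2 : ℂ) • (tmul 1 1 : MinTensor Scalars.{u} Scalars.{u}) = 0 := by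
    rw [two_smul, add_eq_zero_iff_eq_neg, key]
  exact Scalars.tmul_one_one_ne_zero ((smul_eq_zero_iff_right two_ne_zero).1 two_smul_eq_zero)

end FreeCircles

theorem DirectedGraph.IsEdgeSymmetry.not_areIsomorphicCQG {V E : Type u} [Fintype V] [Fintype E]
    {Γ : DirectedGraph V E} {σ : Equiv.Perm E} (h : Γ.IsEdgeSymmetry σ)
    (hσ : Function.Involutive σ) {e₀ : E} (he₀ : σ e₀ ≠ e₀) {Q : Type u} [CStarAlgebra Q]
    {Δ : Q →⋆ₐ[ℂ] MinTensor Q Q} {α : Γ.CStar →⋆ₐ[ℂ] MinTensor Γ.CStar Q}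
    (universal : Γ.IsUniversalObject Δ α) : ¬ AreIsomorphicCQG Δ (FreeCircles.comul E) := by
  intro iso
  obtain ⟨Φ, surj, hΦ, -⟩ := universal.2 _ _ _ (h.isObject hσ he₀)
  exact FreeCircles.not_charactersCommute_doublingComul he₀
    ((FreeCircles.charactersCommute_comul.of_areIsomorphicCQG iso).of_surjective hΦ surj)

end

theorem mainTheorem3_general {V E : Type u} [Fintype V] [Fintype E]
    (Γ : DirectedGraph V E) :
    (∀ e₁ e₂ : E, e₁ ≠ e₂ → Γ.s e₁ = Γ.s e₂ → Γ.r e₁ = Γ.r e₂ →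
      (IsCompactQuantumGroup (FreeCircles.comul E) ∧
        ∃ φ : FreeCircles E ≃⋆ₐ[ℂ] FreeCircles E,
          φ (FreeCircles.z e₁) = FreeCircles.z e₂ ∧
          φ (FreeCircles.z e₂) = FreeCircles.z e₁ ∧
          (∀ k, k ≠ e₁ → k ≠ e₂ → φ (FreeCircles.z k) = FreeCircles.z k) ∧
          (∀ a, φ (φ a) = a) ∧
          IsCQGMorphism (FreeCircles.comul E) (FreeCircles.comul E)
            (φ : FreeCircles E →⋆ₐ[ℂ] FreeCircles E) ∧
          ∃ α : Γ.CStar →⋆ₐ[ℂ] MinTensor Γ.CStar (FreeCircles E × FreeCircles E),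
            α (Γ.S e₁) = MinTensor.tmul (Γ.S e₁) (FreeCircles.z e₁, 0) +
              MinTensor.tmul (Γ.S e₂) (0, FreeCircles.z e₂) ∧
            α (Γ.S e₂) = MinTensor.tmul (Γ.S e₂) (FreeCircles.z e₂, 0) +
              MinTensor.tmul (Γ.S e₁) (0, FreeCircles.z e₁) ∧
            (∀ k, k ≠ e₁ → k ≠ e₂ →
              α (Γ.S k) = MinTensor.tmul (Γ.S k) (FreeCircles.z k, FreeCircles.z k)) ∧
            Γ.IsObject (doublingComul (FreeCircles.comul E)
              (φ : FreeCircles E →⋆ₐ[ℂ] FreeCircles E)) α) ∧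
      (∀ (Q : Type u) [CStarAlgebra Q] (Δ : Q →⋆ₐ[ℂ] MinTensor Q Q)
        (α : Γ.CStar →⋆ₐ[ℂ] MinTensor Γ.CStar Q), Γ.IsUniversalObject Δ α →
        ¬ AreIsomorphicCQG Δ (FreeCircles.comul E))) ∧
    (∀ (Q : Type u) [CStarAlgebra Q] (Δ : Q →⋆ₐ[ℂ] MinTensor Q Q)
      (α : Γ.CStar →⋆ₐ[ℂ] MinTensor Γ.CStar Q), Γ.IsUniversalObject Δ α →
      AreIsomorphicCQG Δ (FreeCircles.comul E) → Γ.SatisfiesR3) := by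
  classical
  have swap_ne {e₁ e₂ : E} (hne : e₁ ≠ e₂) : Equiv.swap e₁ e₂ e₁ ≠ e₁ := by
    rw [Equiv.swap_apply_left]
    exact hne.symm
  refine ⟨fun e₁ e₂ hne hs hr => ?_, fun Q _ Δ α universal iso e f hs hr => ?_⟩
  · have symm := Γ.isEdgeSymmetry_swap hs hr
    have invol : Function.Involutive (Equiv.swap e₁ e₂) := Equiv.swap_apply_self e₁ e₂
    refine ⟨⟨FreeCircles.isCompactQuantumGroup, FreeCircles.permEquiv (Equiv.swap e₁ e₂),
      ?_, ?_, fun k hk₁ hk₂ => ?_, FreeCircles.map_map_of_leftInverse invol,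
      FreeCircles.isCQGMorphism_map _, doubledAction Γ.circleAction symm.permHom,
      ?_, ?_, fun k hk₁ hk₂ => ?_, symm.isObject invol (swap_ne hne)⟩,
      fun _ _ _ _ => symm.not_areIsomorphicCQG invol (swap_ne hne)⟩
    · exact (FreeCircles.map_z _ e₁).trans (by rw [Equiv.swap_apply_left])
    · exact (FreeCircles.map_z _ e₂).trans (by rw [Equiv.swap_apply_right])
    · exact (FreeCircles.map_z _ k).trans (by rw [Equiv.swap_apply_of_ne_of_ne hk₁ hk₂])
    · rw [symm.doubledAction_circleAction_S, Equiv.swap_apply_left]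
    · rw [symm.doubledAction_circleAction_S, Equiv.swap_apply_right]
    · rw [symm.doubledAction_circleAction_S, Equiv.swap_apply_of_ne_of_ne hk₁ hk₂,
        ← MinTensor.tmul_add, Prod.mk_add_mk, add_zero, zero_add]
  · by_contra hne
    exact (Γ.isEdgeSymmetry_swap hs hr).not_areIsomorphicCQG (Equiv.swap_apply_self e f)
      (swap_ne hne) universal iso

theorem mainTheorem3 {V E : Type u} [Fintype V] [Fintype E] (Γ : DirectedGraph V E)
    (hΓ : Γ.IsConnected) :
    (∀ e₁ e₂ : E, e₁ ≠ e₂ → Γ.s e₁ = Γ.s e₂ → Γ.r e₁ = Γ.r e₂ →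
      -- the doubling of the free product acts faithfully on the graph C*-algebra in the category
      (IsCompactQuantumGroup (FreeCircles.comul E) ∧
        ∃ φ : FreeCircles E ≃⋆ₐ[ℂ] FreeCircles E,
          φ (FreeCircles.z e₁) = FreeCircles.z e₂ ∧
          φ (FreeCircles.z e₂) = FreeCircles.z e₁ ∧
          (∀ k, k ≠ e₁ → k ≠ e₂ → φ (FreeCircles.z k) = FreeCircles.z k) ∧
          (∀ a, φ (φ a) = a) ∧
          IsCQGMorphism (FreeCircles.comul E) (FreeCircles.comul E)
            (φ : FreeCircles E →⋆ₐ[ℂ] FreeCircles E) ∧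
          ∃ α : Γ.CStar →⋆ₐ[ℂ] MinTensor Γ.CStar (FreeCircles E × FreeCircles E),
            α (Γ.S e₁) = MinTensor.tmul (Γ.S e₁) (FreeCircles.z e₁, 0) +
              MinTensor.tmul (Γ.S e₂) (0, FreeCircles.z e₂) ∧
            α (Γ.S e₂) = MinTensor.tmul (Γ.S e₂) (FreeCircles.z e₂, 0) +
              MinTensor.tmul (Γ.S e₁) (0, FreeCircles.z e₁) ∧
            (∀ k, k ≠ e₁ → k ≠ e₂ →
              α (Γ.S k) = MinTensor.tmul (Γ.S k) (FreeCircles.z k, FreeCircles.z k)) ∧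
            Γ.IsObject (doublingComul (FreeCircles.comul E)
              (φ : FreeCircles E →⋆ₐ[ℂ] FreeCircles E)) α) ∧
      -- the universal object is not isomorphic to the free product
      (∀ (Q : Type u) [CStarAlgebra Q] (Δ : Q →⋆ₐ[ℂ] MinTensor Q Q)
        (α : Γ.CStar →⋆ₐ[ℂ] MinTensor Γ.CStar Q), Γ.IsUniversalObject Δ α →
        ¬ AreIsomorphicCQG Δ (FreeCircles.comul E))) ∧
    -- hence (R3) is necessary for the universal object to be isomorphic to the free product
    (∀ (Q : Type u) [CStarAlgebra Q] (Δ : Q →⋆ₐ[ℂ] MinTensor Q Q)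
      (α : Γ.CStar →⋆ₐ[ℂ] MinTensor Γ.CStar Q), Γ.IsUniversalObject Δ α →
      AreIsomorphicCQG Δ (FreeCircles.comul E) → Γ.SatisfiesR3) :=
  mainTheorem3_general Γ
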